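/- Let $d\in\mathbf N$, let $U\subseteq\mathbf R^d$ be open, $\tau>0$, $\sigma>1$ and $u\in\mathcal D'(U)$ (complex-valued Schwartz distributions). Let $\mathcal E'(U)$ be the strong dual of $C^\infty(U)$, and for $v\in\mathcal E'(U)$ put $\widehat v(\xi)=\langle v,e^{-2\pi i x\cdot\xi}\rangle$, $\xi\in\mathbf R^d$. For open $\Omega\subseteq U$, the Roumieu class $\mathcal E_{\{\tau,\sigma\}}(\Omega)$ consists of all $f\in C^\infty(\Omega)$ such that for every compact $K\subset\Omega$ there are $A,h>0$ with $$|\partial^\alpha f(x)|\le A\,h^{|\alpha|^\sigma}|\alpha|^{\tau|\alpha|^\sigma},\qquad \alpha\in\mathbf N^d,\ x\in K$$ (where $0^0=1$); we write $u\in\mathcal E_{\{\tau,\sigma\}}(\Omega)$ if the restriction of $u$ to $\Omega$ is given by such a function. The singular support $\operatorname{singsupp}_{\{\tau,\sigma\}}(u)$ is the set of all $x_0\in U$ that have no open neighborhood $\Omega\subseteq U$ with $u\in\mathcal E_{\{\tau,\sigma\}}(\Omega)$. The wave front set $\operatorname{WF}_{\{\tau,\sigma\}}(u)\subseteq U\times(\mathbf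 R^d\setminus\{0\})$ is defined as follows: for $x_0\in U$ and $\xi_0\in\mathbf R^d\setminus\{0\}$, $(x_0,\xi_0)\notin\operatorname{WF}_{\{\tau,\sigma\}}(u)$ if and only if there are an open neighborhood $\Omega\subseteq U$ of $x_0$, an open cone $\Gamma\subseteq\mathbf R^d$ containing $\xi_0$, a bounded sequence $(u_N)_{N\in\mathbf N}$ in $\mathcal E'(U)$ with $u_N=u$ on $\Omega$ for all $N$, and constants $A,h>0$ such that $$|\widehat{u_N}(\xi)|\le A\,\frac{h^N\,N!^{\tau/\sigma}}{|\xi|^{\lfloor N^{1/\sigma}\rfloor}},\qquad N\in\mathbf N,\ \xi\in\Gamma\setminus\{0\}.$$ Then, with $\pi_1(x,\xi)=x$, $$\operatorname{singsupp}_{\{\tau,\sigma\}}(u)=\pi_1\bigl(\operatorname{WF}_{\{\tau,\sigma\}}(u)\bigr).$$ -/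

import Mathlib

open Set Filter Topology TopologicalSpace
open scoped ContDiff Distributions

noncomputable section

namespace TauSigma

variable {d : ℕ}

/-! ### The space `C^∞(U)` with its usual locally convex topology -/

/-- Complex valued smooth functions on the open set `U ⊆ ℝ^d`, each represented by its extension
by `0` to the whole space. -/
def smoothSubmodule (U : Opens (EuclideanSpace ℝ (Fin d))) :
    Submodule ℂ (EuclideanSpace ℝ (Fin d) → ℂ) where
  carrier := {φ | ContDiffOn ℝ ∞ φ U ∧ ∀ x, x ∉ U → φ x = 0}
  zero_mem' := ⟨contDiffOn_const, fun _ _ => rfl⟩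
  add_mem' := fun ha hb => ⟨ha.1.add hb.1, fun x hx => by simp [ha.2 x hx, hb.2 x hx]⟩
  smul_mem' := fun c _ ha => ⟨ha.1.const_smul c, fun x hx => by simp [ha.2 x hx]⟩

/-- The space `C^∞(U)`. It is a type of its own, so that it does not inherit the topology of
pointwise convergence. -/
def SmoothSpace (U : Opens (EuclideanSpace ℝ (Fin d))) : Type := smoothSubmodule U

namespace SmoothSpace

variable {U : Opens (EuclideanSpace ℝ (Fin d))}

instance : AddCommGroup (SmoothSpace U) := inferInstanceAs (AddCommGroup (smoothSubmodule U))

instance : Module ℂ (SmoothSpace U) := inferInstanceAs (Module ℂ (smoothSubmodule U))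

/-- The underlying function (extended by `0` outside `U`). -/
def toFun (φ : SmoothSpace U) : EuclideanSpace ℝ (Fin d) → ℂ := φ.1

/-- The element of `C^∞(U)` given by a function that is smooth on `U`: its restriction to `U`. -/
def ofFun (g : EuclideanSpace ℝ (Fin d) → ℂ) (hg : ContDiffOn ℝ ∞ g U) : SmoothSpace U :=
  ⟨(U : Set (EuclideanSpace ℝ (Fin d))).indicator g,
    hg.congr fun _ hx => indicator_of_mem hx g, fun _ hx => indicator_of_notMem hx g⟩

theorem contDiffAt (φ : SmoothSpace U) {x : EuclideanSpace ℝ (Fin d)} (hx : x ∈ U) :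
    ContDiffAt ℝ ∞ φ.toFun x :=
  φ.2.1.contDiffAt (U.isOpen.mem_nhds hx)

theorem bddAbove (φ : SmoothSpace U) (K : Compacts (EuclideanSpace ℝ (Fin d)))
    (hK : (K : Set (EuclideanSpace ℝ (Fin d))) ⊆ U) (n : ℕ) :
    BddAbove (range fun x : K => ‖iteratedFDeriv ℝ n φ.toFun x‖) := by
  have h1 : ContinuousOn (iteratedFDeriv ℝ n φ.toFun) K := fun x hx =>
    ((φ.contDiffAt (hK hx)).continuousAt_iteratedFDeriv
      (by exact_mod_cast le_top)).continuousWithinAt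
  have h2 := K.isCompact.bddAbove_image h1.norm
  rwa [image_eq_range] at h2

/-- The seminorm `φ ↦ sup_{x ∈ K} ‖D^n φ(x)‖` on `C^∞(U)`, for a compact `K ⊆ U`. -/
def supSeminorm (K : Compacts (EuclideanSpace ℝ (Fin d)))
    (hK : (K : Set (EuclideanSpace ℝ (Fin d))) ⊆ U) (n : ℕ) : Seminorm ℂ (SmoothSpace U) :=
  Seminorm.of (fun φ => ⨆ x : K, ‖iteratedFDeriv ℝ n φ.toFun x‖)
    (fun φ ψ => by
      have hφ := φ.bddAbove K hK n
      have hψ := ψ.bddAbove K hK n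
      refine Real.iSup_le (fun x => ?_)
        (add_nonneg (Real.iSup_nonneg fun _ => norm_nonneg _)
          (Real.iSup_nonneg fun _ => norm_nonneg _))
      have hx : (x : EuclideanSpace ℝ (Fin d)) ∈ U := hK x.2
      have e : iteratedFDeriv ℝ n (φ + ψ).toFun x
          = iteratedFDeriv ℝ n φ.toFun x + iteratedFDeriv ℝ n ψ.toFun x :=
        iteratedFDeriv_add_apply ((φ.contDiffAt hx).of_le (by exact_mod_cast le_top))
          ((ψ.contDiffAt hx).of_le (by exact_mod_cast le_top))
      rw [e]
      exact (norm_add_le _ _).trans (add_le_add (le_ciSup hφ x) (le_ciSup hψ x)))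
    (fun c φ => by
      rw [Real.mul_iSup_of_nonneg (norm_nonneg c)]
      refine iSup_congr fun x => ?_
      have hx : (x : EuclideanSpace ℝ (Fin d)) ∈ U := hK x.2
      have e : iteratedFDeriv ℝ n (c • φ).toFun x = c • iteratedFDeriv ℝ n φ.toFun x :=
        iteratedFDeriv_const_smul_apply ((φ.contDiffAt hx).of_le (by exact_mod_cast le_top))
      rw [e, norm_smul])

/-- The defining family of seminorms of `C^∞(U)`: uniform convergence of all derivatives on the
compact subsets of `U`. -/
def seminormFamily (U : Opens (EuclideanSpace ℝ (Fin d))) :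
    SeminormFamily ℂ (SmoothSpace U)
      ({K : Compacts (EuclideanSpace ℝ (Fin d)) //
        (K : Set (EuclideanSpace ℝ (Fin d))) ⊆ U} × ℕ) :=
  fun i => supSeminorm i.1.1 i.1.2 i.2

instance : TopologicalSpace (SmoothSpace U) := (seminormFamily U).moduleFilterBasis.topology

theorem withSeminorms : WithSeminorms (seminormFamily U) :=
  letI : Nonempty ({K : Compacts (EuclideanSpace ℝ (Fin d)) //
    (K : Set (EuclideanSpace ℝ (Fin d))) ⊆ U} × ℕ) := ⟨(⟨⊥, by simp⟩, 0)⟩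
  ⟨rfl⟩

instance : IsTopologicalAddGroup (SmoothSpace U) := withSeminorms.topologicalAddGroup

instance : ContinuousSMul ℂ (SmoothSpace U) := withSeminorms.continuousSMul

/-- The exponential `x ↦ e^{-2π i x·ξ}` as an element of `C^∞(U)`. -/
def expChar (U : Opens (EuclideanSpace ℝ (Fin d))) (ξ : EuclideanSpace ℝ (Fin d)) :
    SmoothSpace U :=
  ofFun (fun x => Complex.exp (((-2 * Real.pi * inner ℝ x ξ : ℝ) : ℂ) * Complex.I)) <| by
    have h : ContDiff ℝ ∞ fun x : EuclideanSpace ℝ (Fin d) => -2 * Real.pi * inner ℝ x ξ := by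
      exact contDiff_const.mul (contDiff_id.inner ℝ contDiff_const)
    exact (((Complex.ofRealCLM.contDiff.comp h).mul contDiff_const).cexp).contDiffOn

/-- A real test function on `U`, as an element of `C^∞(U)`. -/
def ofTest (φ : 𝓓(U, ℝ)) : SmoothSpace U :=
  ofFun (fun x => (φ x : ℂ)) (Complex.ofRealCLM.contDiff.comp φ.contDiff).contDiffOn

end SmoothSpace

/-! ### Compactly supported distributions -/

/-- `𝓔'(U)`, the distributions with compact support in `U`: the strong dual of `C^∞(U)`
(the topology on `→L[ℂ]` is that of uniform convergence on bounded sets). -/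
abbrev CompactDistribution (U : Opens (EuclideanSpace ℝ (Fin d))) : Type :=
  SmoothSpace U →L[ℂ] ℂ

/-- The Fourier transform `û(ξ) = ⟨u, e^{-2π i x·ξ}⟩` of a compactly supported distribution. -/
def fourierTransform {U : Opens (EuclideanSpace ℝ (Fin d))} (u : CompactDistribution U)
    (ξ : EuclideanSpace ℝ (Fin d)) : ℂ :=
  u (SmoothSpace.expChar U ξ)

/-- `v = u` on the open set `Ω ⊆ U`, for `v ∈ 𝓔'(U)` and `u ∈ 𝓓'(U)`. -/
def EqOnOpen {U : Opens (EuclideanSpace ℝ (Fin d))} (v : CompactDistribution U) (u : 𝓓'(U, ℂ))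
    (Ω : Opens (EuclideanSpace ℝ (Fin d))) : Prop :=
  ∀ φ : 𝓓(U, ℝ), tsupport φ ⊆ Ω → v (SmoothSpace.ofTest φ) = u φ

/-! ### The wave front set -/

/-- `Γ` is a conic neighbourhood of `ξ₀`: an open cone that contains `ξ₀`. -/
def IsConicNhd (Γ : Set (EuclideanSpace ℝ (Fin d))) (ξ₀ : EuclideanSpace ℝ (Fin d)) : Prop :=
  IsOpen Γ ∧ (∀ ξ ∈ Γ, ∀ t : ℝ, 0 < t → t • ξ ∈ Γ) ∧ ξ₀ ∈ Γ

/-- The decay condition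
`|û_N(ξ)| ≤ A h^N N!^{τ/σ} / |ξ|^{⌊N^{1/σ}⌋}` for all `N ∈ ℕ` and `ξ ∈ Γ`, `ξ ≠ 0`. -/
def DecayOn {U : Opens (EuclideanSpace ℝ (Fin d))} (τ σ : ℝ) (uN : ℕ → CompactDistribution U)
    (Γ : Set (EuclideanSpace ℝ (Fin d))) : Prop :=
  ∃ A h : ℝ, 0 < A ∧ 0 < h ∧ ∀ N : ℕ, ∀ ξ ∈ Γ, ξ ≠ 0 →
    ‖fourierTransform (uN N) ξ‖ ≤
      A * (h ^ N * (N.factorial : ℝ) ^ (τ / σ)) / ‖ξ‖ ^ ⌊(N : ℝ) ^ (1 / σ)⌋₊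

/-- The wave front set `WF_{τ,σ}(u)` (Roumieu case) of `u ∈ 𝓓'(U)`,
a subset of `U × (ℝ^d ∖ {0})`. -/
def waveFrontSet {U : Opens (EuclideanSpace ℝ (Fin d))} (τ σ : ℝ) (u : 𝓓'(U, ℂ)) :
    Set (EuclideanSpace ℝ (Fin d) × EuclideanSpace ℝ (Fin d)) :=
  {p | p.1 ∈ U ∧ p.2 ≠ 0 ∧
    ¬ ∃ Ω : Opens (EuclideanSpace ℝ (Fin d)), Ω ≤ U ∧ p.1 ∈ Ω ∧
      ∃ Γ : Set (EuclideanSpace ℝ (Fin d)), IsConicNhd Γ p.2 ∧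
        ∃ uN : ℕ → CompactDistribution U,
          Bornology.IsVonNBounded ℂ (range uN) ∧ (∀ N, EqOnOpen (uN N) u Ω) ∧
            DecayOn τ σ uN Γ}

/-! ### The regularity class and the singular support -/

/-- The partial derivative `∂f/∂x_i`. -/
def partialDeriv (i : Fin d) (f : EuclideanSpace ℝ (Fin d) → ℂ) :
    EuclideanSpace ℝ (Fin d) → ℂ :=
  fun x => fderiv ℝ f x (EuclideanSpace.single i 1)

/-- `∂^α f = ∂_1^{α_1} ⋯ ∂_d^{α_d} f` for a multi-index `α`. -/
def multiDeriv (α : Fin d → ℕ) (f : EuclideanSpace ℝ (Fin d) → ℂ) :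
    EuclideanSpace ℝ (Fin d) → ℂ :=
  (List.finRange d).foldr (fun i g => (partialDeriv i)^[α i] g) f

/-- `f` belongs to the Roumieu class `𝓔_{τ,σ}(Ω)`: it is smooth on `Ω` and for every compact
`K ⊆ Ω` there are `A, h > 0` with `|∂^α f(x)| ≤ A h^{|α|^σ} |α|^{τ |α|^σ}` for all multi-indices
`α` and all `x ∈ K`. -/
def IsRegularOn (τ σ : ℝ) (f : EuclideanSpace ℝ (Fin d) → ℂ)
    (Ω : Opens (EuclideanSpace ℝ (Fin d))) : Prop :=
  ContDiffOn ℝ ∞ f Ω ∧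
    ∀ K : Set (EuclideanSpace ℝ (Fin d)), IsCompact K → K ⊆ Ω →
      ∃ A h : ℝ, 0 < A ∧ 0 < h ∧ ∀ α : Fin d → ℕ, ∀ x ∈ K,
        ‖multiDeriv α f x‖ ≤
          A * (h ^ (((∑ i, α i : ℕ) : ℝ) ^ σ) *
            ((∑ i, α i : ℕ) : ℝ) ^ (τ * ((∑ i, α i : ℕ) : ℝ) ^ σ))

/-- `u ∈ 𝓔_{τ,σ}(Ω)` for a distribution `u` on `U ⊇ Ω`: on `Ω` it is given by integration
against a function of that class. -/
def BelongsTo {U : Opens (EuclideanSpace ℝ (Fin d))} (τ σ : ℝ) (u : 𝓓'(U, ℂ))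
    (Ω : Opens (EuclideanSpace ℝ (Fin d))) : Prop :=
  ∃ f : EuclideanSpace ℝ (Fin d) → ℂ, IsRegularOn τ σ f Ω ∧
    ∀ φ : 𝓓(U, ℝ), tsupport φ ⊆ Ω → u φ = ∫ x, (φ x : ℂ) * f x

/-- The singular support of `u ∈ 𝓓'(U)` with respect to the Roumieu classes `𝓔_{τ,σ}`. -/
def singSupp {U : Opens (EuclideanSpace ℝ (Fin d))} (τ σ : ℝ) (u : 𝓓'(U, ℂ)) :
    Set (EuclideanSpace ℝ (Fin d)) :=
  {x | x ∈ U ∧ ¬ ∃ Ω : Opens (EuclideanSpace ℝ (Fin d)), Ω ≤ U ∧ x ∈ Ω ∧ BelongsTo τ σ u Ω}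

end TauSigma

end

/-!
The inclusion `singsupp ⊆ π₁ WF` and its converse are both reduced to decay of Fourier transforms
in terms of the weights `e^{a k^σ} k^{τ k^σ}`, where `k` is the power of `|ξ|`. Because `σ > 1`,
these weights absorb geometric factors, factorials and shifts `k ↦ k + D`, and superadditivity of
`k ↦ k^σ` makes them submultiplicative (`weight_mul_le`, `exists_weight_add_le`,
`factorial_le_exp`). With `m = ⌊N^{1/σ}⌋` the quantity `h^N N!^{τ/σ}` of the wave front set is
comparable to the weight of index `m` (`weight_floor_le`, `exists_floor_eq_and_le_weight`). In
particular the classes contain compactly supported Gevrey functions, so a single cutoff function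
`χ` with weight bounds can be used for all `N` (`exists_cutoff`).

If `u` is given near `x₀` by a function `f` of the class, then `χ f` is again of the class by
Leibniz' rule, integrating by parts bounds `|ξ|^m |(χ f)^(ξ)|` by weights, and the constant
sequence `u_N = χ f` shows that no `(x₀, ξ)` lies in the wave front set
(`not_mem_waveFrontSet_of_belongsTo`).

Conversely, suppose that no `(x₀, ξ)` lies in the wave front set. Finitely many of the resulting
cones cover all directions; `χ` is supported where all the corresponding `u_N` agree with `u`.
Then `χ u = χ u_N` for every `N` and every cone, and its Fourier transform is the convolution of
`χ̂` with `û_N`. Boundedness of `(u_N)` in the strong dual gives a polynomial bound for `û_N`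
that is uniform in `N` (`exists_fourierTransform_le`), and splitting the convolution at
`|ξ - ζ| = ε |ξ|` yields weighted decay of `(χ u)^` in each cone (`exists_decay_in_cone`), hence
everywhere. Fourier inversion then represents `u` near `x₀` by a function of the class
(`isRegularOn_fourier`). Both the convolution formula and the inversion rest on Parseval's formula
for `𝓔'(U)` (`apply_eq_integral_fourierInv`), which is proved by factoring an element of `𝓔'(U)`
through a Banach space of jets, where Bochner integrals are available.
-/

namespace TauSigma

/-! ### The weight sequences `exp (a k^σ + τ k^σ log k)` -/

/-- The weight `e^{a k^σ} k^{τ k^σ}`, equal to `1` for `k = 0` since `0 ^ σ = 0`. With `a = log h`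
this is the bound `h^{k^σ} k^{τ k^σ}` that defines the class `𝓔_{τ,σ}`; the exponential form makes
the parameter `a` additive. -/
noncomputable def weight (τ σ a : ℝ) (k : ℕ) : ℝ :=
  Real.exp (a * (k : ℝ) ^ σ + τ * ((k : ℝ) ^ σ * Real.log k))

theorem weight_pos (τ σ a : ℝ) (k : ℕ) : 0 < weight τ σ a k := Real.exp_pos _

theorem weight_eq {τ σ h : ℝ} (hσ : 1 < σ) (hh : 0 < h) (k : ℕ) :
    h ^ ((k : ℝ) ^ σ) * (k : ℝ) ^ (τ * (k : ℝ) ^ σ) = weight τ σ (Real.log h) k := by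
  rcases Nat.eq_zero_or_pos k with rfl | hk
  · simp [weight, Real.zero_rpow (by linarith : σ ≠ 0)]
  · have hk' : (0 : ℝ) < k := by exact_mod_cast hk
    rw [weight, Real.rpow_def_of_pos hh,
      Real.rpow_def_of_pos hk' (τ * _), ← Real.exp_add]
    congr 1
    ring

theorem weight_mono {τ σ a b : ℝ} (h : a ≤ b) (k : ℕ) : weight τ σ a k ≤ weight τ σ b k := by
  unfold weight
  have : (0 : ℝ) ≤ (k : ℝ) ^ σ := by positivity
  gcongr

theorem natCast_le_rpow {σ : ℝ} (hσ : 1 < σ) (k : ℕ) : (k : ℝ) ≤ (k : ℝ) ^ σ := by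
  rcases Nat.eq_zero_or_pos k with rfl | hk
  · simp [Real.zero_rpow (by linarith : σ ≠ 0)]
  · exact Real.self_le_rpow_of_one_le (by exact_mod_cast hk) hσ.le

/-- Superadditivity of `k ↦ k ^ σ` makes the weights submultiplicative. -/
theorem weight_mul_le {τ σ a : ℝ} (hτ : 0 < τ) (hσ : 1 < σ) (ha : 0 ≤ a) (j l : ℕ) :
    weight τ σ a j * weight τ σ a l ≤ weight τ σ a (j + l) := by
  unfold weight
  rw [← Real.exp_add]
  have h1 : (j : ℝ) ^ σ + (l : ℝ) ^ σ ≤ ((j + l : ℕ) : ℝ) ^ σ := by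
    push_cast
    exact Real.add_rpow_le_rpow_add (by positivity) (by positivity) hσ.le
  have key : ∀ i : ℕ, i ≤ j + l → Real.log i ≤ Real.log ((j + l : ℕ) : ℝ) := by
    intro i hi
    rcases Nat.eq_zero_or_pos i with rfl | hi0
    · simpa using Real.log_natCast_nonneg (j + l)
    · exact Real.log_le_log (by exact_mod_cast hi0) (by exact_mod_cast hi)
  have h2 := key j (by omega)
  have h3 := key l (by omega)
  have h4 := Real.log_natCast_nonneg (j + l)
  have hj : (0 : ℝ) ≤ (j : ℝ) ^ σ := by positivity
  have hl : (0 : ℝ) ≤ (l : ℝ) ^ σ := by positivity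
  have h5 : (j : ℝ) ^ σ * Real.log j + (l : ℝ) ^ σ * Real.log l
      ≤ ((j + l : ℕ) : ℝ) ^ σ * Real.log ((j + l : ℕ) : ℝ) := by
    calc _ ≤ (j : ℝ) ^ σ * Real.log ((j + l : ℕ) : ℝ)
          + (l : ℝ) ^ σ * Real.log ((j + l : ℕ) : ℝ) := by
          gcongr
      _ = ((j : ℝ) ^ σ + (l : ℝ) ^ σ) * Real.log ((j + l : ℕ) : ℝ) := by ring
      _ ≤ _ := by gcongr
  apply Real.exp_le_exp.2
  nlinarith [mul_le_mul_of_nonneg_left h1 ha, mul_le_mul_of_nonneg_left h5 hτ.le]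

/-- Geometric factors `C ^ k` are absorbed by the weights, since `k ≤ k ^ σ`. -/
theorem pow_mul_weight_le {τ σ a C : ℝ} (hσ : 1 < σ) (hC : 1 ≤ C) (k : ℕ) :
    C ^ k * weight τ σ a k ≤ weight τ σ (a + Real.log C) k := by
  have hC0 : 0 < C := by linarith
  rw [← Real.exp_log hC0, ← Real.exp_nat_mul, Real.exp_log hC0]
  unfold weight
  rw [← Real.exp_add]
  apply Real.exp_le_exp.2
  nlinarith [mul_le_mul_of_nonneg_right (natCast_le_rpow hσ k) (Real.log_nonneg hC)]

theorem one_le_weight {τ σ a : ℝ} (hτ : 0 < τ) (ha : 0 ≤ a) (k : ℕ) : 1 ≤ weight τ σ a k := by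
  apply Real.one_le_exp
  have := Real.log_natCast_nonneg k
  positivity

theorem weight_le_of_le {τ σ a : ℝ} (hτ : 0 < τ) (hσ : 1 < σ) (ha : 0 ≤ a) {j k : ℕ} (h : j ≤ k) :
    weight τ σ a j ≤ weight τ σ a k := by
  obtain ⟨l, rfl⟩ := Nat.exists_eq_add_of_le h
  calc weight τ σ a j = weight τ σ a j * 1 := (mul_one _).symm
    _ ≤ weight τ σ a j * weight τ σ a l := by
      gcongr
      · exact (weight_pos _ _ _ _).le
      · exact one_le_weight hτ ha l
    _ ≤ _ := weight_mul_le hτ hσ ha j l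

/-- The mean value inequality for `t ↦ t ^ σ`. -/
theorem succ_rpow_le {σ : ℝ} (hσ : 1 < σ) (k : ℕ) :
    ((k : ℝ) + 1) ^ σ ≤ (k : ℝ) ^ σ + σ * ((k : ℝ) + 1) ^ (σ - 1) := by
  -- Bernoulli's inequality for `(1 - 1 / (k + 1)) ^ σ`
  have hk : (0 : ℝ) < (k : ℝ) + 1 := by positivity
  have h1 := one_add_mul_self_le_rpow_one_add (s := -1 / ((k : ℝ) + 1))
    (by rw [le_div_iff₀ hk]; nlinarith [(Nat.cast_nonneg k : (0 : ℝ) ≤ k)]) hσ.le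
  have h2 : 1 + -1 / ((k : ℝ) + 1) = k / (k + 1) := by field_simp; ring
  rw [h2, Real.div_rpow (by positivity) hk.le] at h1
  have h3 : 0 < ((k : ℝ) + 1) ^ σ := by positivity
  rw [le_div_iff₀ h3] at h1
  have h4 : ((k : ℝ) + 1) ^ σ = ((k : ℝ) + 1) ^ (σ - 1) * (k + 1) := by
    rw [← Real.rpow_add_one hk.ne']; congr 1; ring
  have h5 : (1 + σ * (-1 / ((k : ℝ) + 1))) * ((k : ℝ) + 1) ^ σ
      = ((k : ℝ) + 1) ^ σ - σ * ((k : ℝ) + 1) ^ (σ - 1) := by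
    rw [h4]; field_simp; ring
  linarith

theorem exists_weight_succ_le {τ σ a : ℝ} (hτ : 0 < τ) (hσ : 1 < σ) (ha : 0 ≤ a) :
    ∃ A b : ℝ, 0 < A ∧ 0 ≤ b ∧ ∀ k : ℕ, weight τ σ a (k + 1) ≤ A * weight τ σ b k := by
  -- `(k+1)^σ log (k+1)` exceeds `k^σ log k` by at most a multiple of `k^σ`; the factor `A` serves
  -- only the case `k = 0`
  refine ⟨weight τ σ a 1, a * 2 ^ σ + τ * ((σ + 1) * 2 ^ σ), weight_pos _ _ _ _, by positivity,
    fun k => ?_⟩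
  rcases Nat.eq_zero_or_pos k with rfl | hk
  · have := one_le_weight (σ := σ) hτ (a := a * 2 ^ σ + τ * ((σ + 1) * 2 ^ σ)) (by positivity) 0
    simpa using le_mul_of_one_le_right (weight_pos τ σ a 1).le this
  have hk1 : (1 : ℝ) ≤ k := by exact_mod_cast hk
  have hk0 : (0 : ℝ) < k := by linarith
  have hx : (0 : ℝ) < (k : ℝ) ^ σ := by positivity
  have h2 : ((k : ℝ) + 1) ^ σ ≤ 2 ^ σ * (k : ℝ) ^ σ := by
    rw [← Real.mul_rpow (by norm_num) hk0.le]
    exact Real.rpow_le_rpow (by positivity) (by linarith) (by linarith)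
  have h4 : ((k : ℝ) + 1) ^ σ = ((k : ℝ) + 1) ^ (σ - 1) * (k + 1) := by
    rw [← Real.rpow_add_one (by positivity)]; congr 1; ring
  have hlog : Real.log ((k : ℝ) + 1) ≤ Real.log k + 1 / k := by
    have h := Real.log_le_sub_one_of_pos (x := ((k : ℝ) + 1) / k) (by positivity)
    rw [Real.log_div (by positivity) hk0.ne'] at h
    have : ((k : ℝ) + 1) / k - 1 = 1 / k := by field_simp; ring
    linarith
  have hlogk : Real.log k ≤ k + 1 := by linarith [Real.log_le_sub_one_of_pos hk0]
  have hlog0 : 0 ≤ Real.log (k : ℝ) := Real.log_natCast_nonneg k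
  have h5 : ((k : ℝ) + 1) ^ σ * Real.log ((k : ℝ) + 1)
      ≤ (k : ℝ) ^ σ * Real.log k + (σ + 1) * 2 ^ σ * (k : ℝ) ^ σ := by
    have e1 : ((k : ℝ) + 1) ^ σ * Real.log ((k : ℝ) + 1)
        ≤ ((k : ℝ) + 1) ^ σ * Real.log k + ((k : ℝ) + 1) ^ σ * (1 / k) := by
      rw [← mul_add]; gcongr
    have e2 : ((k : ℝ) + 1) ^ σ * Real.log k
        ≤ (k : ℝ) ^ σ * Real.log k + σ * ((k : ℝ) + 1) ^ σ := by
      calc _ ≤ ((k : ℝ) ^ σ + σ * ((k : ℝ) + 1) ^ (σ - 1)) * Real.log k := by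
            gcongr; exact succ_rpow_le hσ k
        _ = (k : ℝ) ^ σ * Real.log k + σ * (((k : ℝ) + 1) ^ (σ - 1) * Real.log k) := by ring
        _ ≤ _ := by rw [h4]; gcongr
    have e3 : ((k : ℝ) + 1) ^ σ * (1 / k) ≤ ((k : ℝ) + 1) ^ σ := by
      apply mul_le_of_le_one_right (by positivity)
      rw [div_le_one hk0]; exact hk1
    have e4 := mul_le_mul_of_nonneg_left h2 (by linarith : 0 ≤ σ + 1)
    nlinarith
  refine le_trans ?_ (le_mul_of_one_le_left (weight_pos _ _ _ _).le (one_le_weight hτ ha 1))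
  apply Real.exp_le_exp.2
  push_cast
  nlinarith [mul_le_mul_of_nonneg_left h2 ha, mul_le_mul_of_nonneg_left h5 hτ.le]

/-- The weights are stable under shifts of the index. -/
theorem exists_weight_add_le {τ σ a : ℝ} (hτ : 0 < τ) (hσ : 1 < σ) (ha : 0 ≤ a) (D : ℕ) :
    ∃ A b : ℝ, 0 < A ∧ 0 ≤ b ∧ ∀ k : ℕ, weight τ σ a (k + D) ≤ A * weight τ σ b k := by
  induction D with
  | zero => exact ⟨1, a, one_pos, ha, fun k => by simp⟩
  | succ D ih =>
    obtain ⟨A, b, hA, hb, h⟩ := ih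
    obtain ⟨A', b', hA', hb', h'⟩ := exists_weight_succ_le hτ hσ hb
    refine ⟨A * A', b', by positivity, hb', fun k => ?_⟩
    calc weight τ σ a (k + (D + 1)) = weight τ σ a (k + 1 + D) := by congr 1; ring
      _ ≤ A * weight τ σ b (k + 1) := h _
      _ ≤ A * (A' * weight τ σ b' k) := by gcongr; exact h' k
      _ = _ := by ring

/-- Factorials are negligible: `k! ≤ k ^ k ≤ exp (k ^ σ / (σ - 1))`. -/
theorem factorial_le_exp {σ : ℝ} (hσ : 1 < σ) (k : ℕ) :
    (k.factorial : ℝ) ≤ Real.exp ((k : ℝ) ^ σ / (σ - 1)) := by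
  rcases Nat.eq_zero_or_pos k with rfl | hk
  · simp [Real.zero_rpow (by linarith : σ ≠ 0)]
  have hk0 : (0 : ℝ) < k := by exact_mod_cast hk
  calc (k.factorial : ℝ) ≤ (k : ℝ) ^ k := by exact_mod_cast Nat.factorial_le_pow k
    _ = Real.exp (k * Real.log k) := by rw [Real.exp_nat_mul, Real.exp_log hk0]
    _ ≤ _ := by
      apply Real.exp_le_exp.2
      have h := Real.log_le_rpow_div hk0.le (by linarith : 0 < σ - 1)
      have e : (k : ℝ) ^ σ = k * (k : ℝ) ^ (σ - 1) := by
        rw [mul_comm, ← Real.rpow_add_one hk0.ne']; congr 1; ring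
      rw [e, mul_div_assoc]
      gcongr

theorem floor_rpow_le {σ : ℝ} (hσ : 1 < σ) (N : ℕ) :
    ((⌊(N : ℝ) ^ (1 / σ)⌋₊ : ℕ) : ℝ) ^ σ ≤ N := by
  have h := Nat.floor_le (by positivity : (0 : ℝ) ≤ (N : ℝ) ^ (1 / σ))
  calc _ ≤ ((N : ℝ) ^ (1 / σ)) ^ σ := Real.rpow_le_rpow (by positivity) h (by linarith)
    _ = N := by
        rw [← Real.rpow_mul (by positivity), one_div_mul_cancel (by linarith), Real.rpow_one]

/-- With `m = ⌊N^{1/σ}⌋` the weight `e^{a m^σ} m^{τ m^σ}` is at most `h^N N!^{τ/σ}`. -/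
theorem weight_floor_le {τ σ a : ℝ} (hτ : 0 < τ) (hσ : 1 < σ) (ha : 0 ≤ a) (N : ℕ) :
    weight τ σ a ⌊(N : ℝ) ^ (1 / σ)⌋₊
      ≤ Real.exp (a + τ / σ) ^ N * (N.factorial : ℝ) ^ (τ / σ) := by
  set m := ⌊(N : ℝ) ^ (1 / σ)⌋₊ with hm
  have hmN : (m : ℝ) ^ σ ≤ N := floor_rpow_le hσ N
  have hf : (0 : ℝ) < N.factorial := by exact_mod_cast N.factorial_pos
  rw [← Real.exp_nat_mul, Real.rpow_def_of_pos hf, ← Real.exp_add]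
  apply Real.exp_le_exp.2
  have h1 : (N : ℝ) * Real.log N ≤ N + Real.log N.factorial := by
    rcases Nat.eq_zero_or_pos N with h0 | hN
    · simp [h0]
    have hN0 : (0 : ℝ) < N := by exact_mod_cast hN
    have h := Real.pow_div_factorial_le_exp (N : ℝ) hN0.le N
    rw [div_le_iff₀ hf] at h
    have := Real.log_le_log (by positivity) h
    rwa [Real.log_mul (Real.exp_ne_zero _) hf.ne', Real.log_exp, Real.log_pow] at this
  have h2 : (m : ℝ) ^ σ * (σ * Real.log m) ≤ N * Real.log N := by
    rcases Nat.eq_zero_or_pos m with h0 | hm0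
    · rw [h0]; simp [Real.zero_rpow (by linarith : σ ≠ 0)]
      exact mul_nonneg (by positivity) (Real.log_natCast_nonneg N)
    have hm1 : (0 : ℝ) < m := by exact_mod_cast hm0
    rw [← Real.log_rpow hm1]
    have hx : 0 < (m : ℝ) ^ σ := by positivity
    have hl : Real.log ((m : ℝ) ^ σ) ≤ Real.log N := Real.log_le_log hx hmN
    calc _ ≤ (m : ℝ) ^ σ * Real.log N := by gcongr
      _ ≤ _ := by
        have := Real.log_natCast_nonneg N
        gcongr
  have h3 : τ * ((m : ℝ) ^ σ * Real.log m) = τ / σ * ((m : ℝ) ^ σ * (σ * Real.log m)) := by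
    field_simp
  have h4 : 0 < τ / σ := by positivity
  rw [h3]
  nlinarith [mul_le_mul_of_nonneg_left (h2.trans h1) h4.le, mul_le_mul_of_nonneg_left hmN ha]

/-- Conversely, `N = ⌈m^σ⌉` satisfies `⌊N^{1/σ}⌋ = m`, and for this `N` the quantity
`h^N N!^{τ/σ}` is bounded by a weight. -/
theorem exists_floor_eq_and_le_weight {τ σ h : ℝ} (hτ : 0 < τ) (hσ : 1 < σ) (hh : 0 < h) :
    ∃ a : ℝ, 0 ≤ a ∧ ∀ m : ℕ, ∃ N : ℕ, ⌊(N : ℝ) ^ (1 / σ)⌋₊ = m ∧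
      h ^ N * (N.factorial : ℝ) ^ (τ / σ) ≤ weight τ σ a m := by
  refine ⟨2 * |Real.log h| + τ / σ * 3, by positivity, fun m => ⟨⌈(m : ℝ) ^ σ⌉₊, ?_, ?_⟩⟩
  · set N := ⌈(m : ℝ) ^ σ⌉₊ with hN
    have hσ0 : 0 < 1 / σ := by positivity
    rw [Nat.floor_eq_iff (by positivity)]
    constructor
    · calc (m : ℝ) = ((m : ℝ) ^ σ) ^ (1 / σ) := by
            rw [← Real.rpow_mul (by positivity), mul_one_div_cancel (by linarith), Real.rpow_one]
        _ ≤ _ := Real.rpow_le_rpow (by positivity) (Nat.le_ceil _) hσ0.le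
    · have h1 : (N : ℝ) < (m : ℝ) ^ σ + 1 := Nat.ceil_lt_add_one (by positivity)
      have h2 : (m : ℝ) ^ σ + 1 ≤ ((m : ℝ) + 1) ^ σ := by
        simpa using Real.add_rpow_le_rpow_add (by positivity : (0 : ℝ) ≤ m) zero_le_one hσ.le
      calc (N : ℝ) ^ (1 / σ) < (((m : ℝ) + 1) ^ σ) ^ (1 / σ) :=
            Real.rpow_lt_rpow (by positivity) (h1.trans_le h2) hσ0
        _ = _ := by
            rw [← Real.rpow_mul (by positivity), mul_one_div_cancel (by linarith), Real.rpow_one]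
  · rcases Nat.eq_zero_or_pos m with rfl | hm0
    · simp [weight, Real.zero_rpow (by linarith : σ ≠ 0)]
    set N := ⌈(m : ℝ) ^ σ⌉₊ with hN
    have hm1 : (1 : ℝ) ≤ m := by exact_mod_cast hm0
    have hx1 : 1 ≤ (m : ℝ) ^ σ := Real.one_le_rpow hm1 (by linarith)
    have h1 : (N : ℝ) ≤ (m : ℝ) ^ σ + 1 := (Nat.ceil_lt_add_one (by positivity)).le
    have hxN : (m : ℝ) ^ σ ≤ N := Nat.le_ceil _
    set x := (m : ℝ) ^ σ with hx
    have hlx : Real.log x = σ * Real.log m := by rw [hx, Real.log_rpow (by linarith)]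
    have hf : (0 : ℝ) < N.factorial := by exact_mod_cast N.factorial_pos
    have h2 : Real.log N.factorial ≤ x * Real.log x + 3 * x := by
      have e1 : Real.log N.factorial ≤ N * Real.log N := by
        rw [← Real.log_pow]
        exact Real.log_le_log hf (by exact_mod_cast Nat.factorial_le_pow N)
      have e2 : Real.log N ≤ Real.log x + Real.log 2 := by
        rw [← Real.log_mul (by positivity) (by norm_num)]
        exact Real.log_le_log (by linarith) (by linarith)
      have e3 : Real.log 2 ≤ 1 := by linarith [Real.log_two_lt_d9]
      have e4 : Real.log x ≤ x - 1 := Real.log_le_sub_one_of_pos (by linarith)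
      have e5 : 0 ≤ Real.log x := Real.log_nonneg hx1
      calc _ ≤ N * Real.log N := e1
        _ ≤ (x + 1) * (Real.log x + 1) := by
          have : 0 ≤ Real.log N := Real.log_natCast_nonneg N
          gcongr
          linarith
        _ ≤ _ := by nlinarith
    rw [← Real.exp_log hh, ← Real.exp_nat_mul, Real.exp_log hh, Real.rpow_def_of_pos hf,
      ← Real.exp_add]
    apply Real.exp_le_exp.2
    have h4 : 0 < τ / σ := by positivity
    have h5 : (N : ℝ) * Real.log h ≤ 2 * |Real.log h| * x := by
      have : (N : ℝ) * Real.log h ≤ N * |Real.log h| := by gcongr; exact le_abs_self _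
      nlinarith [abs_nonneg (Real.log h)]
    have h6 : τ * (x * Real.log m) = τ / σ * (x * Real.log x) := by rw [hlx]; field_simp
    rw [h6]
    nlinarith [mul_le_mul_of_nonneg_left h2 h4.le]

/-! ### Cutoff functions with weight bounds -/

/-- A smooth function all of whose derivatives obey, uniformly on the whole space, the bounds
of the class `𝓔_{τ,σ}`. -/
def WeightBounded {E : Type*} [NormedAddCommGroup E] [NormedSpace ℝ E] (τ σ : ℝ) (f : E → ℝ) :
    Prop :=
  ContDiff ℝ ∞ f ∧ ∃ A a : ℝ, 0 ≤ A ∧ 0 ≤ a ∧ ∀ (k : ℕ) (x : E),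
    ‖iteratedFDeriv ℝ k f x‖ ≤ A * weight τ σ a k

section WeightBounded

variable {E : Type*} [NormedAddCommGroup E] [NormedSpace ℝ E] {τ σ : ℝ}

/-- The Leibniz sum of two sequences bounded by weights is bounded by a weight. -/
theorem sum_choose_mul_le (hτ : 0 < τ) (hσ : 1 < σ) {A B a b : ℝ} (hA : 0 ≤ A) (hB : 0 ≤ B)
    (ha : 0 ≤ a) {p q : ℕ → ℝ} (hq0 : ∀ k, 0 ≤ q k)
    (hp : ∀ k, p k ≤ A * weight τ σ a k) (hq : ∀ k, q k ≤ B * weight τ σ b k) (k : ℕ) :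
    ∑ i ∈ Finset.range (k + 1), (k.choose i : ℝ) * p i * q (k - i)
      ≤ A * B * weight τ σ (max a b + Real.log 2) k := by
  have hm : 0 ≤ max a b := le_max_of_le_left ha
  calc _ ≤ ∑ i ∈ Finset.range (k + 1), (k.choose i : ℝ) * (A * B * weight τ σ (max a b) k) := by
        refine Finset.sum_le_sum fun i hi => ?_
        rw [mul_assoc]
        have hik : i + (k - i) = k := by have := Finset.mem_range.1 hi; omega
        have hw := weight_mul_le hτ hσ hm i (k - i)
        rw [hik] at hw
        refine mul_le_mul_of_nonneg_left ?_ (by positivity)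
        calc p i * q (k - i) ≤ (A * weight τ σ a i) * (B * weight τ σ b (k - i)) := by
              have := (weight_pos τ σ a i).le
              exact mul_le_mul (hp i) (hq _) (hq0 _) (by positivity)
          _ ≤ (A * weight τ σ (max a b) i) * (B * weight τ σ (max a b) (k - i)) := by
              have h1 := (weight_pos τ σ b (k - i)).le
              have h2 := (weight_pos τ σ (max a b) i).le
              gcongr
              · exact weight_mono (le_max_left _ _) _
              · exact weight_mono (le_max_right _ _) _
          _ = A * B * (weight τ σ (max a b) i * weight τ σ (max a b) (k - i)) := by ring
          _ ≤ _ := by gcongr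
    _ = A * B * (2 ^ k * weight τ σ (max a b) k) := by
        rw [← Finset.sum_mul, ← Nat.cast_sum, Nat.sum_range_choose]; push_cast; ring
    _ ≤ _ := by
        gcongr
        exact pow_mul_weight_le hσ (by norm_num) k

theorem WeightBounded.mul (hτ : 0 < τ) (hσ : 1 < σ) {f g : E → ℝ} (hf : WeightBounded τ σ f)
    (hg : WeightBounded τ σ g) : WeightBounded τ σ fun x => f x * g x := by
  obtain ⟨hf, A, a, hA, ha, h1⟩ := hf
  obtain ⟨hg, B, b, hB, hb, h2⟩ := hg
  refine ⟨hf.mul hg, A * B, max a b + Real.log 2, by positivity,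
    add_nonneg (le_max_of_le_left ha) (Real.log_nonneg (by norm_num)), fun k x => ?_⟩
  refine (norm_iteratedFDeriv_mul_le hf hg x (n := k) (by exact_mod_cast le_top)).trans ?_
  exact sum_choose_mul_le hτ hσ hA hB ha (p := fun i => ‖iteratedFDeriv ℝ i f x‖)
    (q := fun i => ‖iteratedFDeriv ℝ i g x‖) (fun _ => norm_nonneg _) (fun i => h1 i x)
    (fun i => h2 i x) k

theorem WeightBounded.const (hτ : 0 < τ) (c : ℝ) : WeightBounded τ σ fun _ : E => c := by
  refine ⟨contDiff_const, |c|, 0, abs_nonneg c, le_rfl, fun k x => ?_⟩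
  have hw := one_le_weight (σ := σ) hτ le_rfl k
  rcases Nat.eq_zero_or_pos k with rfl | hk
  · rw [norm_iteratedFDeriv_zero, Real.norm_eq_abs]
    exact le_mul_of_one_le_right (abs_nonneg c) hw
  · rw [iteratedFDeriv_const_of_ne hk.ne']
    simp only [Pi.zero_apply, norm_zero]
    positivity

theorem WeightBounded.prod (hτ : 0 < τ) (hσ : 1 < σ) {ι : Type*} (s : Finset ι) {f : ι → E → ℝ}
    (hf : ∀ i, WeightBounded τ σ (f i)) : WeightBounded τ σ fun x => ∏ i ∈ s, f i x := by
  classical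
  induction s using Finset.induction_on with
  | empty => simpa using WeightBounded.const hτ 1
  | insert i s hi ih =>
    simp only [Finset.prod_insert hi]
    exact (hf i).mul hτ hσ ih

theorem norm_iteratedFDeriv_comp_affine_le {F G : Type*} [NormedAddCommGroup F] [NormedSpace ℝ F]
    [NormedAddCommGroup G] [NormedSpace ℝ G] {f : F → G} (hf : ContDiff ℝ ∞ f)
    (L : E →L[ℝ] F) (c : F) (k : ℕ) (x : E) :
    ‖iteratedFDeriv ℝ k (fun y => f (L y + c)) x‖
      ≤ ‖iteratedFDeriv ℝ k f (L x + c)‖ * ‖L‖ ^ k := by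
  have hg : ContDiff ℝ ∞ fun t => f (t + c) := hf.comp (contDiff_id.add contDiff_const)
  have h2 := L.iteratedFDeriv_comp_right hg x (i := k) (by exact_mod_cast le_top)
  change ‖iteratedFDeriv ℝ k ((fun t => f (t + c)) ∘ L) x‖ ≤ _
  rw [h2]
  refine (ContinuousMultilinearMap.norm_compContinuousLinearMap_le _ _).trans ?_
  rw [iteratedFDeriv_comp_add_right, Finset.prod_const, Finset.card_univ, Fintype.card_fin]

theorem WeightBounded.comp_affine (hσ : 1 < σ) {f : ℝ → ℝ} (hf : WeightBounded τ σ f)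
    (L : E →L[ℝ] ℝ) (c : ℝ) : WeightBounded τ σ fun x => f (L x + c) := by
  obtain ⟨hf, A, a, hA, ha, h1⟩ := hf
  have hC : 1 ≤ max 1 ‖L‖ := le_max_left _ _
  refine ⟨hf.comp (L.contDiff.add contDiff_const), A, a + Real.log (max 1 ‖L‖), hA,
    add_nonneg ha (Real.log_nonneg hC), fun k x => ?_⟩
  refine (norm_iteratedFDeriv_comp_affine_le hf L c k x).trans ?_
  calc _ ≤ A * weight τ σ a k * (max 1 ‖L‖) ^ k := by
        gcongr
        · exact mul_nonneg hA (weight_pos _ _ _ _).le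
        · exact h1 k _
        · exact le_max_right _ _
    _ = A * ((max 1 ‖L‖) ^ k * weight τ σ a k) := by ring
    _ ≤ _ := by gcongr; exact pow_mul_weight_le hσ hC k

theorem WeightBounded.of_deriv (hτ : 0 < τ) (hσ : 1 < σ) {f g : ℝ → ℝ}
    (hfg : ∀ t, HasDerivAt f (g t) t) (hg : WeightBounded τ σ g) {B : ℝ} (hB : ∀ t, |f t| ≤ B) :
    WeightBounded τ σ f := by
  obtain ⟨hg, A, a, hA, ha, h1⟩ := hg
  have hd : deriv f = g := funext fun t => (hfg t).deriv
  have hB0 : 0 ≤ B := (abs_nonneg _).trans (hB 0)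
  refine ⟨contDiff_infty_iff_deriv.2 ⟨fun t => (hfg t).differentiableAt, hd ▸ hg⟩, A + B, a,
    by positivity, ha, fun k x => ?_⟩
  cases k with
  | zero =>
    rw [norm_iteratedFDeriv_zero, Real.norm_eq_abs]
    refine (hB x).trans ?_
    nlinarith [one_le_weight (σ := σ) hτ ha 0]
  | succ k =>
    rw [norm_iteratedFDeriv_eq_norm_iteratedDeriv, iteratedDeriv_succ', hd,
      ← norm_iteratedFDeriv_eq_norm_iteratedDeriv]
    refine (h1 k x).trans ?_
    have := weight_pos τ σ a k
    have := weight_le_of_le hτ hσ ha (Nat.le_succ k)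
    gcongr
    linarith

end WeightBounded

open Polynomial in
/-- One step of the recursion for the polynomials in the derivatives of `exp (-1/x)`: the degree
grows by `2`, and the sum of the absolute values of the coefficients by at most the factor
`n + 1`. -/
theorem sum_abs_coeff_le (p : ℝ[X]) (n : ℕ) (hp : p.natDegree ≤ n) {C : ℝ}
    (hC : ∑ i ∈ Finset.range (n + 1), |p.coeff i| ≤ C) :
    (X ^ 2 * (p - derivative p)).natDegree ≤ n + 2 ∧
      ∑ i ∈ Finset.range (n + 2 + 1), |(X ^ 2 * (p - derivative p)).coeff i| ≤ (n + 1) * C := by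
  constructor
  · refine natDegree_mul_le.trans ?_
    have h1 : (p - derivative p).natDegree ≤ n :=
      (natDegree_sub_le _ _).trans (max_le hp ((natDegree_derivative_le p).trans (by omega)))
    rw [natDegree_X_pow]
    omega
  have e : ∑ i ∈ Finset.range (n + 2 + 1), |(X ^ 2 * (p - derivative p)).coeff i|
      = ∑ i ∈ Finset.range (n + 1), |(p - derivative p).coeff i| := by
    rw [show n + 2 + 1 = n + 1 + 1 + 1 by ring, Finset.sum_range_succ', Finset.sum_range_succ']
    simp [coeff_X_pow_mul']
  have e2 : ∑ i ∈ Finset.range (n + 1), |p.coeff (i + 1) * ((i : ℝ) + 1)| ≤ n * C := by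
    have hn : p.coeff (n + 1) = 0 := coeff_eq_zero_of_natDegree_lt (by omega)
    rw [Finset.sum_range_succ, hn]
    calc _ ≤ ∑ i ∈ Finset.range n, (n : ℝ) * |p.coeff (i + 1)| := by
          simp only [zero_mul, abs_zero, add_zero]
          refine Finset.sum_le_sum fun i hi => ?_
          rw [abs_mul, mul_comm]
          have : ((i : ℝ) + 1) ≤ n := by exact_mod_cast Finset.mem_range.1 hi
          rw [abs_of_nonneg (by positivity : (0 : ℝ) ≤ (i : ℝ) + 1)]
          gcongr
      _ = n * ∑ i ∈ Finset.range n, |p.coeff (i + 1)| := by rw [Finset.mul_sum]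
      _ ≤ _ := by
          gcongr
          refine le_trans ?_ hC
          rw [Finset.sum_range_succ']
          linarith [abs_nonneg (p.coeff 0)]
  rw [e]
  calc _ ≤ ∑ i ∈ Finset.range (n + 1), (|p.coeff i| + |p.coeff (i + 1) * ((i : ℝ) + 1)|) := by
        refine Finset.sum_le_sum fun i _ => ?_
        rw [coeff_sub, coeff_derivative]
        exact abs_sub _ _
    _ ≤ _ := by rw [Finset.sum_add_distrib]; linarith

open Polynomial in
theorem iteratedDeriv_expNegInvGlue (k : ℕ) : ∃ p : ℝ[X], p.natDegree ≤ 2 * k ∧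
    ∑ i ∈ Finset.range (2 * k + 1), |p.coeff i| ≤ (2 * k).factorial ∧
    iteratedDeriv k expNegInvGlue = fun x => p.eval x⁻¹ * expNegInvGlue x := by
  induction k with
  | zero => exact ⟨1, by simp, by simp, by simp⟩
  | succ k ih =>
    obtain ⟨p, h1, h2, h3⟩ := ih
    obtain ⟨h4, h5⟩ := sum_abs_coeff_le p (2 * k) h1 h2
    refine ⟨X ^ 2 * (p - derivative p), h4, h5.trans ?_, ?_⟩
    · rw [show 2 * (k + 1) = 2 * k + 1 + 1 by ring, Nat.factorial_succ, Nat.factorial_succ]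
      push_cast
      have : (0 : ℝ) < (2 * k).factorial := by exact_mod_cast Nat.factorial_pos _
      have hk : (0 : ℝ) ≤ k := by positivity
      nlinarith [mul_nonneg (by positivity : (0 : ℝ) ≤ 2 * k + 1) this.le]
    · rw [iteratedDeriv_succ, h3]
      exact funext fun x => (expNegInvGlue.hasDerivAt_polynomial_eval_inv_mul p x).deriv

/-- The flat function `exp (-1/x)` is a Gevrey function, and the weights dominate all Gevrey
bounds because `σ > 1`. -/
theorem weightBounded_expNegInvGlue {τ σ : ℝ} (hτ : 0 < τ) (hσ : 1 < σ) :
    WeightBounded τ σ expNegInvGlue := by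
  refine ⟨expNegInvGlue.contDiff, 1, 2 * (2 ^ σ / (σ - 1)), zero_le_one,
    mul_nonneg zero_le_two (div_nonneg (by positivity) (by linarith)), fun k x => ?_⟩
  obtain ⟨p, h1, h2, h3⟩ := iteratedDeriv_expNegInvGlue k
  rw [norm_iteratedFDeriv_eq_norm_iteratedDeriv, h3, Real.norm_eq_abs, one_mul]
  rcases le_or_gt x 0 with hx | hx
  · simp [expNegInvGlue.zero_of_nonpos hx, (weight_pos _ _ _ _).le]
  have hy : 0 < x⁻¹ := by positivity
  have hval : expNegInvGlue x = Real.exp (-x⁻¹) := by simp [expNegInvGlue, hx.not_ge]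
  have hterm : ∀ i ∈ Finset.range (2 * k + 1),
      |p.coeff i * x⁻¹ ^ i| * Real.exp (-x⁻¹) ≤ |p.coeff i| * (2 * k).factorial := by
    intro i hi
    rw [abs_mul, abs_of_pos (pow_pos hy i), mul_assoc]
    refine mul_le_mul_of_nonneg_left ?_ (abs_nonneg _)
    have hf : (0 : ℝ) < i.factorial := by exact_mod_cast i.factorial_pos
    have h := Real.pow_div_factorial_le_exp x⁻¹ hy.le i
    rw [div_le_iff₀ hf] at h
    rw [Real.exp_neg, ← div_eq_mul_inv, div_le_iff₀ (Real.exp_pos _), mul_comm]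
    refine h.trans ?_
    gcongr
    have := Finset.mem_range.1 hi
    omega
  calc |p.eval x⁻¹ * expNegInvGlue x|
      = |∑ i ∈ Finset.range (2 * k + 1), p.coeff i * x⁻¹ ^ i| * Real.exp (-x⁻¹) := by
        rw [abs_mul, hval, abs_of_pos (Real.exp_pos _),
          Polynomial.eval_eq_sum_range' (Nat.lt_succ_of_le h1)]
    _ ≤ (∑ i ∈ Finset.range (2 * k + 1), |p.coeff i * x⁻¹ ^ i|) * Real.exp (-x⁻¹) := by
        gcongr; exact Finset.abs_sum_le_sum_abs _ _
    _ ≤ ∑ i ∈ Finset.range (2 * k + 1), |p.coeff i| * (2 * k).factorial := by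
        rw [Finset.sum_mul]; exact Finset.sum_le_sum hterm
    _ ≤ (2 * k).factorial * (2 * k).factorial := by rw [← Finset.sum_mul]; gcongr
    _ ≤ Real.exp (((2 * k : ℕ) : ℝ) ^ σ / (σ - 1))
          * Real.exp (((2 * k : ℕ) : ℝ) ^ σ / (σ - 1)) := by
        gcongr <;> exact factorial_le_exp hσ _
    _ ≤ _ := by
        rw [← Real.exp_add]
        apply Real.exp_le_exp.2
        have : (0 : ℝ) ≤ τ * ((k : ℝ) ^ σ * Real.log k) := by
          have := Real.log_natCast_nonneg k; positivity
        push_cast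
        rw [Real.mul_rpow zero_le_two (by positivity)]
        have e : 2 * (2 ^ σ / (σ - 1)) * (k : ℝ) ^ σ
          = 2 ^ σ * (k : ℝ) ^ σ / (σ - 1) + 2 ^ σ * (k : ℝ) ^ σ / (σ - 1) := by ring
        linarith

/-- The step function is the normalized primitive of `exp (-1/s) exp (-1/(1-s))`; in this way no
quotient of functions has to be differentiated. -/
theorem exists_weightBounded_step {τ σ : ℝ} (hτ : 0 < τ) (hσ : 1 < σ) :
    ∃ Ψ : ℝ → ℝ, WeightBounded τ σ Ψ ∧ (∀ t ≤ 0, Ψ t = 0) ∧ ∀ t, 1 ≤ t → Ψ t = 1 := by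
  set g : ℝ → ℝ := fun s => expNegInvGlue s * expNegInvGlue (1 - s) with hg
  have hG := weightBounded_expNegInvGlue hτ hσ
  have hgW : WeightBounded τ σ g := by
    refine hG.mul hτ hσ ?_
    have := hG.comp_affine hσ (-ContinuousLinearMap.id ℝ ℝ) 1
    convert this using 3
    simp only [neg_apply, ContinuousLinearMap.id_apply]
    ring
  have hgc : Continuous g := hgW.1.continuous
  have hg0 : ∀ s, s ∉ Ioo (0 : ℝ) 1 → g s = 0 := by
    intro s hs
    rcases le_or_gt s 0 with h | h
    · simp [hg, expNegInvGlue.zero_of_nonpos h]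
    · have : 1 - s ≤ 0 := by by_contra h'; exact hs ⟨h, by linarith⟩
      simp [hg, expNegInvGlue.zero_of_nonpos this]
  set c : ℝ := ∫ s in (0 : ℝ)..1, g s with hc
  have hcpos : 0 < c := by
    refine intervalIntegral.intervalIntegral_pos_of_pos_on (hgc.intervalIntegrable _ _)
      (fun s hs => ?_) one_pos
    exact mul_pos (expNegInvGlue.pos_of_pos hs.1) (expNegInvGlue.pos_of_pos (by linarith [hs.2]))
  set P : ℝ → ℝ := fun t => ∫ s in (0 : ℝ)..t, g s with hP
  have hP0 : ∀ t ≤ 0, P t = 0 := by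
    intro t ht
    refine intervalIntegral.integral_zero_ae (Eventually.of_forall fun s hs => hg0 s ?_)
    rw [uIoc_of_ge ht] at hs
    exact fun h => absurd h.1 (not_lt.2 hs.2)
  have hP1 : ∀ t, 1 ≤ t → P t = c := by
    intro t ht
    have : ∫ s in (1 : ℝ)..t, g s = 0 := by
      refine intervalIntegral.integral_zero_ae (Eventually.of_forall fun s hs => hg0 s ?_)
      rw [uIoc_of_le ht] at hs
      exact fun h => absurd h.2 (not_lt.2 hs.1.le)
    change (∫ s in (0 : ℝ)..t, g s) = c
    rw [← intervalIntegral.integral_add_adjacent_intervals (hgc.intervalIntegrable 0 1)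
      (hgc.intervalIntegrable 1 t), this, add_zero]
  have hPd : ∀ t, HasDerivAt P (g t) t := fun t =>
    intervalIntegral.integral_hasDerivAt_right (hgc.intervalIntegrable _ _)
      hgc.stronglyMeasurable.stronglyMeasurableAtFilter hgc.continuousAt
  have hPc : Continuous P := continuous_iff_continuousAt.2 fun t => (hPd t).continuousAt
  obtain ⟨B, hB⟩ := isCompact_Icc.exists_bound_of_continuousOn (s := Icc (0 : ℝ) 1)
    hPc.continuousOn
  have hPB : ∀ t, |P t| ≤ B := by
    intro t
    rcases le_or_gt t 0 with h | h
    · have := hB 0 (by simp); rw [hP0 0 le_rfl] at this; rw [hP0 t h]; exact this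
    · rcases le_or_gt t 1 with h' | h'
      · exact hB t ⟨h.le, h'⟩
      · have := hB 1 (by simp); rw [hP1 1 le_rfl] at this; rw [hP1 t h'.le]; exact this
  refine ⟨fun t => c⁻¹ * P t, (WeightBounded.const hτ _).mul hτ hσ
    (WeightBounded.of_deriv hτ hσ hPd hgW hPB), fun t ht => by simp [hP0 t ht], fun t ht => ?_⟩
  simp only [hP1 t ht]
  exact inv_mul_cancel₀ hcpos.ne'

variable {d : ℕ}

theorem norm_le_sum_abs (x : EuclideanSpace ℝ (Fin d)) : ‖x‖ ≤ ∑ i, |x i| := by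
  conv_lhs => rw [← (EuclideanSpace.basisFun (Fin d) ℝ).sum_repr x]
  refine (norm_sum_le _ _).trans (Finset.sum_le_sum fun i _ => ?_)
  rw [norm_smul]
  simp

/-- Near every point there are cutoff functions with weight bounds. -/
theorem exists_cutoff {τ σ : ℝ} (hτ : 0 < τ) (hσ : 1 < σ) (x₀ : EuclideanSpace ℝ (Fin d))
    {V : Set (EuclideanSpace ℝ (Fin d))} (hV : V ∈ 𝓝 x₀) :
    ∃ χ : EuclideanSpace ℝ (Fin d) → ℝ, WeightBounded τ σ χ ∧ HasCompactSupport χ ∧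
      tsupport χ ⊆ V ∧ ∀ᶠ x in 𝓝 x₀, χ x = 1 := by
  obtain ⟨Ψ, hΨ, hΨ0, hΨ1⟩ := exists_weightBounded_step hτ hσ
  obtain ⟨r, hr, hrV⟩ := Metric.mem_nhds_iff.1 hV
  set δ : ℝ := r / (4 * (d + 1)) with hδ
  have hδ0 : 0 < δ := by positivity
  let p : Fin d → EuclideanSpace ℝ (Fin d) →L[ℝ] ℝ := fun i => δ⁻¹ • EuclideanSpace.proj i
  let θ : Fin d → EuclideanSpace ℝ (Fin d) → ℝ := fun i x =>
    Ψ (p i x + (2 - δ⁻¹ * x₀ i)) * Ψ ((-p i) x + (2 + δ⁻¹ * x₀ i))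
  have hθ : ∀ i x, θ i x = Ψ (2 + (x i - x₀ i) / δ) * Ψ (2 - (x i - x₀ i) / δ) := by
    intro i x
    have e1 : p i x + (2 - δ⁻¹ * x₀ i) = 2 + (x i - x₀ i) / δ := by
      simp [p]; ring
    have e2 : (-p i) x + (2 + δ⁻¹ * x₀ i) = 2 - (x i - x₀ i) / δ := by
      simp [p]; ring
    simp only [θ, e1, e2]
  have hθ0 : ∀ i x, 2 * δ < |x i - x₀ i| → θ i x = 0 := by
    intro i x h
    rw [hθ]
    rcases lt_abs.1 h with h | h
    · rw [hΨ0 (2 - _), mul_zero]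
      rw [sub_nonpos, le_div_iff₀ hδ0]; exact h.le
    · rw [hΨ0 (2 + _), zero_mul]
      have : 2 ≤ -(x i - x₀ i) / δ := by rw [le_div_iff₀ hδ0]; exact h.le
      rw [neg_div] at this; linarith
  have hθ1 : ∀ i x, |x i - x₀ i| < δ → θ i x = 1 := by
    intro i x h
    rw [hθ]
    have h2 : |(x i - x₀ i) / δ| < 1 := by
      rw [abs_div, abs_of_pos hδ0, div_lt_one hδ0]; exact h
    rw [abs_lt] at h2
    rw [hΨ1 _ (by linarith), hΨ1 _ (by linarith), mul_one]
  have hsupp : Function.support (fun x => ∏ i, θ i x) ⊆ Metric.closedBall x₀ (r / 2) := by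
    intro x hx
    rw [Metric.mem_closedBall, dist_eq_norm]
    refine (norm_le_sum_abs _).trans ?_
    calc ∑ i, |(x - x₀) i| ≤ ∑ _i : Fin d, 2 * δ := by
          refine Finset.sum_le_sum fun i _ => ?_
          by_contra h
          exact hx (Finset.prod_eq_zero (Finset.mem_univ i) (hθ0 i x (not_le.1 h)))
      _ = d * (2 * δ) := by simp
      _ ≤ r / 2 := by
          have : (d + 1) * (2 * δ) = r / 2 := by rw [hδ]; field_simp; norm_num
          nlinarith
  have hts : tsupport (fun x => ∏ i, θ i x) ⊆ Metric.closedBall x₀ (r / 2) :=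
    closure_minimal hsupp Metric.isClosed_closedBall
  refine ⟨fun x => ∏ i, θ i x, WeightBounded.prod hτ hσ _ fun i =>
    (hΨ.comp_affine hσ _ _).mul hτ hσ (hΨ.comp_affine hσ _ _),
    HasCompactSupport.of_support_subset_isCompact (isCompact_closedBall x₀ (r / 2)) hsupp,
    hts.trans ((Metric.closedBall_subset_ball (by linarith)).trans hrV), ?_⟩
  have : ∀ᶠ x in 𝓝 x₀, ∀ i, |x i - x₀ i| < δ := by
    refine eventually_all.2 fun i => ?_
    have hc : Continuous fun x : EuclideanSpace ℝ (Fin d) => |x i - x₀ i| := by fun_prop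
    exact hc.continuousAt.eventually_lt continuousAt_const (by simpa using hδ0)
  filter_upwards [this] with x hx
  exact Finset.prod_eq_one fun i _ => hθ1 i x (hx i)

open MeasureTheory FourierTransform

/-! ### Iterated partial derivatives and Fourier decay -/

theorem contDiffOn_partialDeriv {f : EuclideanSpace ℝ (Fin d) → ℂ}
    {Ω : Set (EuclideanSpace ℝ (Fin d))} (hΩ : IsOpen Ω) (hf : ContDiffOn ℝ ∞ f Ω) (i : Fin d) :
    ContDiffOn ℝ ∞ (partialDeriv i f) Ω :=
  (hf.fderiv_of_isOpen hΩ (by simp)).clm_apply contDiffOn_const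

theorem contDiffOn_iterate_partialDeriv {f : EuclideanSpace ℝ (Fin d) → ℂ}
    {Ω : Set (EuclideanSpace ℝ (Fin d))} (hΩ : IsOpen Ω) (hf : ContDiffOn ℝ ∞ f Ω) (i : Fin d)
    (k : ℕ) : ContDiffOn ℝ ∞ ((partialDeriv i)^[k] f) Ω := by
  induction k with
  | zero => exact hf
  | succ k ih =>
    rw [Function.iterate_succ_apply']
    exact contDiffOn_partialDeriv hΩ ih i

/-- Iterated partial derivatives are iterated derivatives along lines parallel to an axis. -/
theorem iterate_partialDeriv_eq {f : EuclideanSpace ℝ (Fin d) → ℂ}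
    {Ω : Set (EuclideanSpace ℝ (Fin d))} (hΩ : IsOpen Ω) (hf : ContDiffOn ℝ ∞ f Ω) (i : Fin d)
    (k : ℕ) : ∀ x ∈ Ω, (partialDeriv i)^[k] f x
      = iteratedDeriv k (fun t : ℝ => f (x + t • EuclideanSpace.single i 1)) 0 := by
  induction k with
  | zero => intro x _; simp
  | succ k ih =>
    intro x hx
    set e : EuclideanSpace ℝ (Fin d) := EuclideanSpace.single i 1
    have hcont : Continuous fun t : ℝ => x + t • e := by fun_prop
    have hev : ∀ᶠ t : ℝ in 𝓝 0, x + t • e ∈ Ω :=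
      hcont.continuousAt.eventually_mem (hΩ.mem_nhds (by simpa using hx))
    have h1 : iteratedDeriv k (fun t : ℝ => f (x + t • e))
        =ᶠ[𝓝 0] fun t => (partialDeriv i)^[k] f (x + t • e) := by
      filter_upwards [hev] with t ht
      rw [ih _ ht]
      have := congrFun (iteratedDeriv_comp_const_add k (fun s : ℝ => f (x + s • e)) t) 0
      simp only [add_zero] at this
      rw [← this]
      congr 1
      funext s
      rw [add_smul, add_assoc]
    rw [Function.iterate_succ_apply', iteratedDeriv_succ, h1.deriv_eq]
    have hd : DifferentiableAt ℝ ((partialDeriv i)^[k] f) x :=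
      ((contDiffOn_iterate_partialDeriv hΩ hf i k).contDiffAt (hΩ.mem_nhds hx)).differentiableAt
        (by simp)
    have hl : HasDerivAt (fun t : ℝ => x + t • e) e 0 := by
      simpa using ((hasDerivAt_id (0 : ℝ)).smul_const e).const_add x
    have hd' : HasFDerivAt ((partialDeriv i)^[k] f) (fderiv ℝ ((partialDeriv i)^[k] f) x)
        (x + (0 : ℝ) • e) := by simpa using hd.hasFDerivAt
    exact (hd'.comp_hasDerivAt (0 : ℝ) hl).deriv.symm

theorem multiDeriv_single (i : Fin d) (k : ℕ) (f : EuclideanSpace ℝ (Fin d) → ℂ) :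
    multiDeriv (Pi.single i k) f = (partialDeriv i)^[k] f := by
  have key : ∀ l : List (Fin d), l.Nodup →
      l.foldr (fun j g => (partialDeriv j)^[(Pi.single i k : Fin d → ℕ) j] g) f
        = if i ∈ l then (partialDeriv i)^[k] f else f := by
    intro l
    induction l with
    | nil => simp
    | cons a l ih =>
      intro hl
      rw [List.nodup_cons] at hl
      rw [List.foldr_cons, ih hl.2]
      by_cases h : i = a
      · subst h; simp [hl.1]
      · simp [h]
  have := key _ (List.nodup_finRange d)
  simpa [multiDeriv] using this

theorem tsupport_iterate_partialDeriv_subset (f : EuclideanSpace ℝ (Fin d) → ℂ) (i : Fin d)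
    (k : ℕ) : tsupport ((partialDeriv i)^[k] f) ⊆ tsupport f := by
  induction k with
  | zero => exact subset_rfl
  | succ k ih =>
    rw [Function.iterate_succ_apply']
    exact (tsupport_fderiv_apply_subset ℝ _).trans ih

theorem fourier_iterate_partialDeriv {f : EuclideanSpace ℝ (Fin d) → ℂ} (hf : ContDiff ℝ ∞ f)
    (hs : HasCompactSupport f) (i : Fin d) (k : ℕ) (ξ : EuclideanSpace ℝ (Fin d)) :
    𝓕 ((partialDeriv i)^[k] f) ξ = (2 * Real.pi * Complex.I * ξ i) ^ k * 𝓕 f ξ := by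
  induction k with
  | zero => simp
  | succ k ih =>
    have hc : ContDiff ℝ ∞ ((partialDeriv i)^[k] f) := by
      rw [← contDiffOn_univ] at hf ⊢
      exact contDiffOn_iterate_partialDeriv isOpen_univ hf i k
    have hs' : HasCompactSupport ((partialDeriv i)^[k] f) :=
      hs.of_isClosed_subset (isClosed_tsupport _) (tsupport_iterate_partialDeriv_subset f i k)
    have hcd : Continuous (fderiv ℝ ((partialDeriv i)^[k] f)) := hc.continuous_fderiv (by simp)
    have hint := hcd.integrable_of_hasCompactSupport (μ := volume) (hs'.fderiv ℝ)
    have h1 := Real.fourier_fderiv (hc.continuous.integrable_of_hasCompactSupport hs')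
      (hc.differentiable (by simp)) hint
    rw [Function.iterate_succ_apply']
    change 𝓕 (fun x => fderiv ℝ ((partialDeriv i)^[k] f) x (EuclideanSpace.single i 1)) ξ = _
    rw [← Real.fourier_continuousLinearMap_apply hint, h1, VectorFourier.fourierSMulRight_apply, ih]
    have hi : innerSL ℝ ξ (EuclideanSpace.single i 1) = ξ i := by
      rw [innerSL_apply_apply, EuclideanSpace.inner_single_right]
      simp
    simp [hi]
    ring

/-- A smooth function supported in a compact set whose pure partial derivatives obey weight
bounds has a Fourier transform that decays accordingly. -/
theorem exists_fourier_decay {τ σ : ℝ} (hτ : 0 < τ) (hσ : 1 < σ)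
    {f : EuclideanSpace ℝ (Fin d) → ℂ} (hf : ContDiff ℝ ∞ f)
    (hs : HasCompactSupport f) {A a : ℝ} (hA : 0 ≤ A) (ha : 0 ≤ a)
    (hbd : ∀ (i : Fin d) (k : ℕ) (x : EuclideanSpace ℝ (Fin d)),
      ‖(partialDeriv i)^[k] f x‖ ≤ A * weight τ σ a k) :
    ∃ B b : ℝ, 0 < B ∧ 0 ≤ b ∧ ∀ (k : ℕ) (ξ : EuclideanSpace ℝ (Fin d)),
      ‖ξ‖ ^ k * ‖𝓕 f ξ‖ ≤ B * weight τ σ b k := by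
  set v := volume.real (tsupport f) with hv
  have hC : (1 : ℝ) ≤ max 1 (d : ℝ) := le_max_left _ _
  -- the summand `‖𝓕 f 0‖` takes care of `ξ = 0`, where `‖ξ‖ ^ 0 = 1`
  have hb : 0 ≤ a + Real.log (max 1 (d : ℝ)) := add_nonneg ha (Real.log_nonneg hC)
  refine ⟨A * v + 1 + ‖𝓕 f 0‖, a + Real.log (max 1 (d : ℝ)), by positivity, hb, fun k ξ => ?_⟩
  have hw := weight_pos τ σ (a + Real.log (max 1 (d : ℝ))) k
  rcases eq_or_ne ξ 0 with rfl | hξ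
  · calc ‖(0 : EuclideanSpace ℝ (Fin d))‖ ^ k * ‖𝓕 f 0‖ ≤ ‖𝓕 f 0‖ * 1 := by
          rw [norm_zero, mul_one]
          exact mul_le_of_le_one_left (norm_nonneg _) (pow_le_one₀ le_rfl zero_le_one)
      _ ≤ _ := by
          have : 0 ≤ A * v + 1 := by positivity
          exact mul_le_mul (by linarith) (one_le_weight hτ hb k) zero_le_one (by positivity)
  have hd : (Finset.univ : Finset (Fin d)).Nonempty := by
    rw [Finset.univ_nonempty_iff]
    by_contra h
    rw [not_nonempty_iff] at h
    exact hξ (Subsingleton.elim _ _)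
  obtain ⟨i, -, hi⟩ := Finset.exists_max_image Finset.univ (fun i => |ξ i|) hd
  have h1 : ‖ξ‖ ≤ max 1 (d : ℝ) * |ξ i| := by
    calc ‖ξ‖ ≤ ∑ j, |ξ j| := norm_le_sum_abs ξ
      _ ≤ ∑ _j : Fin d, |ξ i| := Finset.sum_le_sum fun j hj => hi j hj
      _ = d * |ξ i| := by simp
      _ ≤ _ := by gcongr; exact le_max_right _ _
  have h2 : |ξ i| ^ k * ‖𝓕 f ξ‖ ≤ A * weight τ σ a k * v := by
    calc |ξ i| ^ k * ‖𝓕 f ξ‖ ≤ (2 * Real.pi * |ξ i|) ^ k * ‖𝓕 f ξ‖ := by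
          gcongr
          have := Real.pi_gt_three
          nlinarith [abs_nonneg (ξ i)]
      _ = ‖𝓕 ((partialDeriv i)^[k] f) ξ‖ := by
          rw [fourier_iterate_partialDeriv hf hs, norm_mul, norm_pow]
          simp [abs_of_pos Real.pi_pos]
      _ ≤ ∫ x, ‖(partialDeriv i)^[k] f x‖ :=
          VectorFourier.norm_fourierIntegral_le_integral_norm _ _ _ _ _
      _ = ∫ x in tsupport f, ‖(partialDeriv i)^[k] f x‖ := by
          refine (setIntegral_eq_integral_of_forall_compl_eq_zero fun x hx => ?_).symm
          rw [image_eq_zero_of_notMem_tsupport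
            (fun h => hx (tsupport_iterate_partialDeriv_subset f i k h)), norm_zero]
      _ ≤ ‖∫ x in tsupport f, ‖(partialDeriv i)^[k] f x‖‖ := Real.le_norm_self _
      _ ≤ _ := by
          refine norm_setIntegral_le_of_norm_le_const hs.isCompact.measure_lt_top fun x _ => ?_
          rw [norm_norm]
          exact hbd i k x
  calc ‖ξ‖ ^ k * ‖𝓕 f ξ‖ ≤ (max 1 (d : ℝ) * |ξ i|) ^ k * ‖𝓕 f ξ‖ := by gcongr
    _ = max 1 (d : ℝ) ^ k * (|ξ i| ^ k * ‖𝓕 f ξ‖) := by ring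
    _ ≤ max 1 (d : ℝ) ^ k * (A * weight τ σ a k * v) := by gcongr
    _ = A * v * (max 1 (d : ℝ) ^ k * weight τ σ a k) := by ring
    _ ≤ A * v * weight τ σ (a + Real.log (max 1 (d : ℝ))) k := by
        gcongr; exact pow_mul_weight_le hσ hC k
    _ ≤ _ := by gcongr; linarith [norm_nonneg (𝓕 f 0)]

theorem contDiff_mul_of_tsupport_subset {χ f : EuclideanSpace ℝ (Fin d) → ℂ}
    {Ω : Set (EuclideanSpace ℝ (Fin d))} (hΩ : IsOpen Ω) {n : ℕ∞ω} (hχ : ContDiff ℝ n χ)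
    (hf : ContDiffOn ℝ n f Ω) (h : tsupport χ ⊆ Ω) : ContDiff ℝ n fun x => χ x * f x := by
  rw [contDiff_iff_contDiffAt]
  intro x
  by_cases hx : x ∈ tsupport χ
  · exact hχ.contDiffAt.mul (hf.contDiffAt (hΩ.mem_nhds (h hx)))
  · have : (fun x => χ x * f x) =ᶠ[𝓝 x] fun _ => 0 := by
      filter_upwards [notMem_tsupport_iff_eventuallyEq.1 hx] with y hy
      simp [hy]
    exact contDiffAt_const.congr_of_eventuallyEq this

theorem norm_iteratedDeriv_line_ofReal_le {χ : EuclideanSpace ℝ (Fin d) → ℝ}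
    (hχ : ContDiff ℝ ∞ χ) (i : Fin d) (k : ℕ) (x : EuclideanSpace ℝ (Fin d)) :
    ‖iteratedDeriv k (fun t : ℝ => (χ (x + t • EuclideanSpace.single i 1) : ℂ)) 0‖
      ≤ ‖iteratedFDeriv ℝ k χ x‖ := by
  set e : EuclideanSpace ℝ (Fin d) := EuclideanSpace.single i 1
  have hχ' : ContDiff ℝ ∞ fun y => (χ y : ℂ) := Complex.ofRealCLM.contDiff.comp hχ
  have h1 := norm_iteratedFDeriv_comp_affine_le hχ' (ContinuousLinearMap.toSpanSingleton ℝ e) x k 0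
  rw [← norm_iteratedFDeriv_eq_norm_iteratedDeriv]
  simp only [ContinuousLinearMap.toSpanSingleton_apply, zero_smul, zero_add,
    ContinuousLinearMap.norm_toSpanSingleton] at h1
  have he : ‖e‖ = 1 := by simp [e]
  rw [he, one_pow, mul_one] at h1
  have h2 := Complex.ofRealLI.norm_iteratedFDeriv_comp_left (hχ.contDiffAt (x := x)) (i := k)
    (by exact_mod_cast le_top)
  refine (le_of_eq ?_).trans (h1.trans h2.le)
  simp only [add_comm x]

theorem WeightBounded.exists_fourier_decay {τ σ : ℝ} (hτ : 0 < τ) (hσ : 1 < σ)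
    {χ : EuclideanSpace ℝ (Fin d) → ℝ} (hχ : WeightBounded τ σ χ) (hs : HasCompactSupport χ) :
    ∃ B b : ℝ, 0 < B ∧ 0 ≤ b ∧ ∀ (k : ℕ) (ξ : EuclideanSpace ℝ (Fin d)),
      ‖ξ‖ ^ k * ‖𝓕 (fun x => (χ x : ℂ)) ξ‖ ≤ B * weight τ σ b k := by
  obtain ⟨hχc, A, a, hA, ha, h1⟩ := hχ
  have hχC : ContDiff ℝ ∞ fun y => (χ y : ℂ) := Complex.ofRealCLM.contDiff.comp hχc
  refine TauSigma.exists_fourier_decay hτ hσ hχC (hs.comp_left Complex.ofReal_zero) hA ha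
    fun i k x => ?_
  rw [iterate_partialDeriv_eq isOpen_univ hχC.contDiffOn i k x (mem_univ x)]
  exact (norm_iteratedDeriv_line_ofReal_le hχc i k x).trans (h1 k x)

/-- Multiplication by a cutoff function turns a member of the class `𝓔_{τ,σ}(Ω)` into a function
with rapidly decaying Fourier transform. -/
theorem IsRegularOn.exists_fourier_decay {τ σ : ℝ} (hτ : 0 < τ) (hσ : 1 < σ)
    {f : EuclideanSpace ℝ (Fin d) → ℂ} {Ω : Opens (EuclideanSpace ℝ (Fin d))}
    (hf : IsRegularOn τ σ f Ω) {χ : EuclideanSpace ℝ (Fin d) → ℝ} (hχ : WeightBounded τ σ χ)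
    (hs : HasCompactSupport χ) (hχΩ : tsupport χ ⊆ Ω) :
    ∃ B b : ℝ, 0 < B ∧ 0 ≤ b ∧ ∀ (k : ℕ) (ξ : EuclideanSpace ℝ (Fin d)),
      ‖ξ‖ ^ k * ‖𝓕 (fun x => (χ x : ℂ) * f x) ξ‖ ≤ B * weight τ σ b k := by
  obtain ⟨hχc, A, a, hA, ha, h1⟩ := hχ
  obtain ⟨B, h, hB, hh, h2⟩ := hf.2 (tsupport χ) hs.isCompact hχΩ
  have hts : tsupport (fun x => (χ x : ℂ)) ⊆ tsupport χ :=
    closure_mono fun x hx hx' => hx (by simp [hx'])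
  have hts' : tsupport (fun x => (χ x : ℂ) * f x) ⊆ tsupport χ :=
    closure_mono fun x hx hx' => hx (by simp [hx'])
  have hsF : HasCompactSupport fun x => (χ x : ℂ) * f x :=
    hs.of_isClosed_subset (isClosed_tsupport _) hts'
  have hχC : ContDiff ℝ ∞ fun y => (χ y : ℂ) := Complex.ofRealCLM.contDiff.comp hχc
  have hF : ContDiff ℝ ∞ fun x => (χ x : ℂ) * f x :=
    contDiff_mul_of_tsupport_subset Ω.isOpen hχC hf.1 (hts.trans hχΩ)
  refine TauSigma.exists_fourier_decay (A := A * B)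
    (a := max a (Real.log h) + Real.log 2) hτ hσ hF hsF (by positivity)
    (add_nonneg (le_max_of_le_left ha) (Real.log_nonneg (by norm_num))) fun i k x => ?_
  by_cases hx : x ∈ tsupport χ
  swap
  · rw [image_eq_zero_of_notMem_tsupport
      (fun h' => hx (hts' (tsupport_iterate_partialDeriv_subset _ i k h'))), norm_zero]
    have := weight_pos τ σ (max a (Real.log h) + Real.log 2) k
    positivity
  set e : EuclideanSpace ℝ (Fin d) := EuclideanSpace.single i 1
  rw [iterate_partialDeriv_eq isOpen_univ hF.contDiffOn i k x (mem_univ x),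
    ← norm_iteratedFDeriv_eq_norm_iteratedDeriv]
  have hl : ContDiff ℝ ∞ fun t : ℝ => x + t • e := by fun_prop
  -- the line through `x` stays in `Ω` only near `x`, so Leibniz' rule is applied within an open set
  set s : Set ℝ := (fun t : ℝ => x + t • e) ⁻¹' Ω
  have hsO : IsOpen s := Ω.isOpen.preimage hl.continuous
  have h0s : (0 : ℝ) ∈ s := by simpa [s] using hχΩ hx
  have hfl : ContDiffOn ℝ ∞ (fun t : ℝ => f (x + t • e)) s :=
    hf.1.comp hl.contDiffOn fun t ht => ht
  have hχl : ContDiffOn ℝ ∞ (fun t : ℝ => (χ (x + t • e) : ℂ)) s := (hχC.comp hl).contDiffOn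
  have hL := norm_iteratedFDerivWithin_mul_le hχl hfl hsO.uniqueDiffOn h0s (n := k)
    (by exact_mod_cast le_top)
  simp only [iteratedFDerivWithin_of_isOpen _ hsO h0s] at hL
  refine hL.trans ?_
  refine sum_choose_mul_le hτ hσ hA hB.le ha
    (p := fun j => ‖iteratedFDeriv ℝ j (fun t : ℝ => (χ (x + t • e) : ℂ)) 0‖)
    (q := fun j => ‖iteratedFDeriv ℝ j (fun t : ℝ => f (x + t • e)) 0‖)
    (fun _ => norm_nonneg _) (fun j => ?_) (fun j => ?_) k
  · simp only [norm_iteratedFDeriv_eq_norm_iteratedDeriv]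
    exact (norm_iteratedDeriv_line_ofReal_le hχc i j x).trans (h1 j x)
  · simp only [norm_iteratedFDeriv_eq_norm_iteratedDeriv]
    rw [← iterate_partialDeriv_eq Ω.isOpen hf.1 i j x (hχΩ hx), ← multiDeriv_single]
    have := h2 (Pi.single i j) x hx
    rw [Finset.sum_pi_single' i j Finset.univ, if_pos (Finset.mem_univ i), weight_eq hσ hh] at this
    exact this

/-! ### Smooth functions as compactly supported distributions -/

namespace SmoothSpace

variable {U : Opens (EuclideanSpace ℝ (Fin d))}

theorem ofFun_toFun_apply {g : EuclideanSpace ℝ (Fin d) → ℂ} (hg : ContDiffOn ℝ ∞ g U)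
    {x : EuclideanSpace ℝ (Fin d)} (hx : x ∈ U) : (ofFun g hg).toFun x = g x :=
  indicator_of_mem hx g

theorem expChar_apply (ξ : EuclideanSpace ℝ (Fin d)) {x : EuclideanSpace ℝ (Fin d)}
    (hx : x ∈ U) : (expChar U ξ).toFun x = 𝐞 (-inner ℝ x ξ) := by
  refine (ofFun_toFun_apply _ hx).trans ?_
  rw [Real.fourierChar_apply]
  congr 2
  push_cast
  ring

theorem ofTest_apply (φ : 𝓓(U, ℝ)) (x : EuclideanSpace ℝ (Fin d)) :
    (ofTest φ).toFun x = φ x := by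
  by_cases hx : x ∈ U
  · exact ofFun_toFun_apply _ hx
  · have h0 : φ x = 0 := image_eq_zero_of_notMem_tsupport fun h => hx (φ.tsupport_subset h)
    rw [h0, Complex.ofReal_zero]
    exact (ofTest φ).2.2 x hx

theorem norm_apply_le_supSeminorm (φ : SmoothSpace U) {K : Compacts (EuclideanSpace ℝ (Fin d))}
    (hK : (K : Set (EuclideanSpace ℝ (Fin d))) ⊆ U) (n : ℕ) {x : EuclideanSpace ℝ (Fin d)}
    (hx : x ∈ K) : ‖iteratedFDeriv ℝ n φ.toFun x‖ ≤ supSeminorm K hK n φ :=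
  le_ciSup (f := fun x : K => ‖iteratedFDeriv ℝ n φ.toFun x‖) (φ.bddAbove K hK n) ⟨x, hx⟩

theorem supSeminorm_le {φ : SmoothSpace U} {K : Compacts (EuclideanSpace ℝ (Fin d))}
    {hK : (K : Set (EuclideanSpace ℝ (Fin d))) ⊆ U} {n : ℕ} {C : ℝ} (hC : 0 ≤ C)
    (h : ∀ x ∈ K, ‖iteratedFDeriv ℝ n φ.toFun x‖ ≤ C) : supSeminorm K hK n φ ≤ C :=
  Real.iSup_le (fun x => h x.1 x.2) hC

end SmoothSpace

theorem continuous_mul_toFun {U : Opens (EuclideanSpace ℝ (Fin d))}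
    {F : EuclideanSpace ℝ (Fin d) → ℂ} (hF : ContDiff ℝ 0 F) (hU : tsupport F ⊆ U)
    (φ : SmoothSpace U) : Continuous fun x => F x * φ.toFun x :=
  contDiff_zero.1 (contDiff_mul_of_tsupport_subset U.isOpen hF (φ.2.1.of_le (by simp)) hU)

theorem integrable_mul_toFun {U : Opens (EuclideanSpace ℝ (Fin d))}
    {F : EuclideanSpace ℝ (Fin d) → ℂ} (hF : ContDiff ℝ 0 F) (hs : HasCompactSupport F)
    (hU : tsupport F ⊆ U) (φ : SmoothSpace U) : Integrable fun x => F x * φ.toFun x :=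
  (continuous_mul_toFun hF hU φ).integrable_of_hasCompactSupport hs.mul_right

/-- Integration against a continuous function with compact support in `U`, as an element
of `𝓔'(U)`. -/
noncomputable def integralDistribution {U : Opens (EuclideanSpace ℝ (Fin d))}
    (F : EuclideanSpace ℝ (Fin d) → ℂ) (hF : ContDiff ℝ 0 F) (hs : HasCompactSupport F)
    (hU : tsupport F ⊆ U) : CompactDistribution U :=
  let l : SmoothSpace U →ₗ[ℂ] ℂ :=
    { toFun := fun φ => ∫ x, F x * φ.toFun x
      map_add' := fun φ ψ => by
        rw [← integral_add (integrable_mul_toFun hF hs hU φ) (integrable_mul_toFun hF hs hU ψ)]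
        refine integral_congr_ae (Eventually.of_forall fun x => ?_)
        exact mul_add (F x) (φ.toFun x) (ψ.toFun x)
      map_smul' := fun c φ => by
        rw [RingHom.id_apply, smul_eq_mul, ← integral_const_mul]
        refine integral_congr_ae (Eventually.of_forall fun x => ?_)
        exact mul_left_comm (F x) c (φ.toFun x) }
  { l with
    cont := by
      set K : Compacts (EuclideanSpace ℝ (Fin d)) := ⟨tsupport F, hs⟩
      refine WithSeminorms.continuous_normedSpace_rng ℂ SmoothSpace.withSeminorms l
        ⟨{(⟨K, hU⟩, 0)}, ⟨∫ x, ‖F x‖, by positivity⟩, fun φ => ?_⟩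
      rw [Finset.sup_singleton]
      change ‖∫ x, F x * φ.toFun x‖ ≤ (∫ x, ‖F x‖) * SmoothSpace.supSeminorm K hU 0 φ
      rw [← integral_mul_const]
      have hFi : Integrable F := hF.continuous.integrable_of_hasCompactSupport hs
      refine norm_integral_le_of_norm_le (hFi.norm.mul_const _) (Eventually.of_forall fun x => ?_)
      rw [norm_mul]
      by_cases hx : x ∈ tsupport F
      · gcongr
        have := φ.norm_apply_le_supSeminorm (K := K) hU 0 hx
        rwa [norm_iteratedFDeriv_zero] at this
      · simp [image_eq_zero_of_notMem_tsupport hx] }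

theorem fourierTransform_integralDistribution {U : Opens (EuclideanSpace ℝ (Fin d))}
    {F : EuclideanSpace ℝ (Fin d) → ℂ} (hF : ContDiff ℝ 0 F) (hs : HasCompactSupport F)
    (hU : tsupport F ⊆ U) (ξ : EuclideanSpace ℝ (Fin d)) :
    fourierTransform (integralDistribution F hF hs hU) ξ = 𝓕 F ξ := by
  rw [Real.fourier_eq]
  change ∫ x, F x * (SmoothSpace.expChar U ξ).toFun x = _
  refine integral_congr_ae (Eventually.of_forall fun x => ?_)
  by_cases hx : x ∈ tsupport F
  · simp only [SmoothSpace.expChar_apply ξ (hU hx)]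
    rw [mul_comm]
    rfl
  · simp [image_eq_zero_of_notMem_tsupport hx]

/-- Points with a neighbourhood on which `u` is regular carry no wave front set: the constant
sequence `u_N = χ f` works in all directions. -/
theorem not_mem_waveFrontSet_of_belongsTo {τ σ : ℝ} (hτ : 0 < τ) (hσ : 1 < σ)
    {U : Opens (EuclideanSpace ℝ (Fin d))} {u : 𝓓'(U, ℂ)} {Ω : Opens (EuclideanSpace ℝ (Fin d))}
    (hΩU : Ω ≤ U) {x₀ : EuclideanSpace ℝ (Fin d)} (hx₀ : x₀ ∈ Ω) (h : BelongsTo τ σ u Ω)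
    (ξ₀ : EuclideanSpace ℝ (Fin d)) : (x₀, ξ₀) ∉ waveFrontSet τ σ u := by
  obtain ⟨f, hf, hfu⟩ := h
  obtain ⟨χ, hχ, hs, hχΩ, hχ1⟩ := exists_cutoff hτ hσ x₀ (Ω.isOpen.mem_nhds hx₀)
  obtain ⟨B, b, hB, hb, hdec⟩ := hf.exists_fourier_decay hτ hσ hχ hs hχΩ
  obtain ⟨W, hWsub, hWo, hxW⟩ := mem_nhds_iff.1 (inter_mem hχ1 (Ω.isOpen.mem_nhds hx₀))
  have hts : tsupport (fun x => (χ x : ℂ)) ⊆ tsupport χ :=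
    closure_mono fun x hx hx' => hx (by simp [hx'])
  have hts' : tsupport (fun x => (χ x : ℂ) * f x) ⊆ tsupport χ :=
    closure_mono fun x hx hx' => hx (by simp [hx'])
  have hsF : HasCompactSupport fun x => (χ x : ℂ) * f x :=
    hs.of_isClosed_subset (isClosed_tsupport _) hts'
  have hF : ContDiff ℝ 0 fun x => (χ x : ℂ) * f x :=
    (contDiff_mul_of_tsupport_subset Ω.isOpen (Complex.ofRealCLM.contDiff.comp hχ.1) hf.1
      (hts.trans hχΩ)).of_le (by simp)
  have hFU : tsupport (fun x => (χ x : ℂ) * f x) ⊆ U := (hts'.trans hχΩ).trans hΩU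
  refine fun hWF => hWF.2.2 ⟨⟨W, hWo⟩, fun x hx => hΩU (hWsub hx).2, hxW, univ,
    ⟨isOpen_univ, fun _ _ _ _ => mem_univ _, mem_univ _⟩,
    fun _ => integralDistribution _ hF hsF hFU, ?_, fun N φ hφ => ?_,
    B, Real.exp (b + τ / σ), hB, Real.exp_pos _, fun N ξ _ hξ => ?_⟩
  · rw [range_const]
    exact Bornology.isVonNBounded_singleton _
  · rw [hfu φ (hφ.trans fun x hx => (hWsub hx).2)]
    change ∫ x, (χ x : ℂ) * f x * (SmoothSpace.ofTest φ).toFun x = _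
    refine integral_congr_ae (Eventually.of_forall fun x => ?_)
    simp only [SmoothSpace.ofTest_apply]
    by_cases hx : x ∈ tsupport φ
    · have hχx : χ x = 1 := (hWsub (hφ hx)).1
      simp [hχx, mul_comm]
    · simp [image_eq_zero_of_notMem_tsupport hx]
  · rw [fourierTransform_integralDistribution, le_div_iff₀ (by positivity), mul_comm]
    refine (hdec _ ξ).trans ?_
    gcongr
    exact weight_floor_le hτ hσ hb N

/-! ### Jets and a Parseval formula for compactly supported distributions -/

/-- A linear form on `V` that is bounded in terms of a linear map `J` into a normed space factors
through `J` by a continuous linear form, by the Hahn–Banach theorem. -/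
theorem exists_factorization {V W : Type*} [AddCommGroup V] [Module ℂ V] [NormedAddCommGroup W]
    [NormedSpace ℂ W] (J : V →ₗ[ℂ] W) (w : V →ₗ[ℂ] ℂ) (C : ℝ) (h : ∀ φ, ‖w φ‖ ≤ C * ‖J φ‖) :
    ∃ ℓ : W →L[ℂ] ℂ, ∀ φ, w φ = ℓ (J φ) := by
  obtain ⟨s, hs⟩ := J.rangeRestrict.exists_rightInverse_of_surjective (J.range_rangeRestrict)
  have hs' : ∀ y : J.range, J (s y) = y := fun y =>
    congrArg Subtype.val (LinearMap.congr_fun hs y)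
  obtain ⟨ℓ, hℓ, -⟩ := exists_extension_norm_eq J.range
    ((w ∘ₗ s).mkContinuous C fun y => by
      have := h (s y)
      rwa [hs' y] at this)
  refine ⟨ℓ, fun φ => ?_⟩
  have h1 := hℓ ⟨J φ, LinearMap.mem_range_self J φ⟩
  rw [h1]
  change w φ = w (s ⟨J φ, _⟩)
  rw [← sub_eq_zero, ← map_sub, ← norm_le_zero_iff]
  refine (h _).trans (le_of_eq ?_)
  rw [map_sub, hs' _, sub_self, norm_zero, mul_zero]

namespace SmoothSpace

variable {U : Opens (EuclideanSpace ℝ (Fin d))}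

/-- The index set of the seminorms of `C^∞(U)`: a compact subset of `U` and an order of
differentiation. -/
abbrev SeminormIndex (U : Opens (EuclideanSpace ℝ (Fin d))) : Type :=
  {K : Compacts (EuclideanSpace ℝ (Fin d)) // (K : Set (EuclideanSpace ℝ (Fin d))) ⊆ U} × ℕ

/-- The Banach space in which the derivatives of order `i.2` live on the compact set `i.1`. It is
a type of its own to keep instance search short. -/
def JetSpace (i : SeminormIndex U) : Type :=
  C(i.1.1, EuclideanSpace ℝ (Fin d) [×i.2]→L[ℝ] ℂ)

noncomputable instance (i : SeminormIndex U) : NormedAddCommGroup (JetSpace i) :=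
  inferInstanceAs (NormedAddCommGroup C(i.1.1, EuclideanSpace ℝ (Fin d) [×i.2]→L[ℝ] ℂ))

noncomputable instance (i : SeminormIndex U) : NormedSpace ℂ (JetSpace i) :=
  inferInstanceAs (NormedSpace ℂ C(i.1.1, EuclideanSpace ℝ (Fin d) [×i.2]→L[ℝ] ℂ))

instance (i : SeminormIndex U) : CompleteSpace (JetSpace i) :=
  inferInstanceAs (CompleteSpace C(i.1.1, EuclideanSpace ℝ (Fin d) [×i.2]→L[ℝ] ℂ))

/-- Evaluation of a jet at a point. -/
noncomputable def evalJet (i : SeminormIndex U) (x : i.1.1) :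
    JetSpace i →L[ℂ] EuclideanSpace ℝ (Fin d) [×i.2]→L[ℝ] ℂ :=
  (ContinuousMap.evalCLM ℂ x :
    C(i.1.1, EuclideanSpace ℝ (Fin d) [×i.2]→L[ℝ] ℂ) →L[ℂ] EuclideanSpace ℝ (Fin d) [×i.2]→L[ℝ] ℂ)

theorem jetSpace_ext {i : SeminormIndex U} {f g : JetSpace i}
    (h : ∀ x, evalJet i x f = evalJet i x g) : f = g :=
  ContinuousMap.ext h

theorem norm_jetSpace_le {i : SeminormIndex U} {f : JetSpace i} {C : ℝ} (hC : 0 ≤ C)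
    (h : ∀ x, ‖evalJet i x f‖ ≤ C) : ‖f‖ ≤ C :=
  (ContinuousMap.norm_le (f : C(i.1.1, EuclideanSpace ℝ (Fin d) [×i.2]→L[ℝ] ℂ)) hC).2 h

theorem norm_evalJet_le {i : SeminormIndex U} (f : JetSpace i) (x : i.1.1) :
    ‖evalJet i x f‖ ≤ ‖f‖ :=
  ContinuousMap.norm_coe_le_norm (f : C(i.1.1, EuclideanSpace ℝ (Fin d) [×i.2]→L[ℝ] ℂ)) x

/-- The derivative of order `i.2` of a smooth function, restricted to the compact set `i.1`. -/
noncomputable def jet (i : SeminormIndex U) : SmoothSpace U →ₗ[ℂ] JetSpace i where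
  toFun φ := (⟨fun x => iteratedFDeriv ℝ i.2 φ.toFun x, continuous_iff_continuousAt.2 fun x =>
    ContinuousAt.comp (f := Subtype.val) ((φ.contDiffAt (i.1.2 x.2)).continuousAt_iteratedFDeriv
      (by exact_mod_cast le_top)) continuous_subtype_val.continuousAt⟩ :
    C(i.1.1, EuclideanSpace ℝ (Fin d) [×i.2]→L[ℝ] ℂ))
  map_add' φ ψ := jetSpace_ext fun x =>
    iteratedFDeriv_add_apply ((φ.contDiffAt (i.1.2 x.2)).of_le (by exact_mod_cast le_top))
      ((ψ.contDiffAt (i.1.2 x.2)).of_le (by exact_mod_cast le_top))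
  map_smul' c φ := jetSpace_ext fun x =>
    iteratedFDeriv_const_smul_apply
      ((φ.contDiffAt (i.1.2 x.2)).of_le (by exact_mod_cast le_top))

theorem evalJet_jet (i : SeminormIndex U) (φ : SmoothSpace U) (x : i.1.1) :
    evalJet i x (jet i φ) = iteratedFDeriv ℝ i.2 φ.toFun x := rfl

theorem seminormFamily_le_norm_jet (i : SeminormIndex U) (φ : SmoothSpace U) :
    seminormFamily U i φ ≤ ‖jet i φ‖ :=
  supSeminorm_le (norm_nonneg (jet i φ)) fun x hx => norm_evalJet_le (jet i φ) ⟨x, hx⟩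

/-- The derivatives of the exponentials in closed form. -/
theorem iteratedFDeriv_expChar (η : EuclideanSpace ℝ (Fin d)) (n : ℕ)
    {x : EuclideanSpace ℝ (Fin d)} (hx : x ∈ U) :
    iteratedFDeriv ℝ n (expChar U η).toFun x
      = 𝐞 (-inner ℝ η x) •
          VectorFourier.fourierPowSMulRight (innerSL ℝ) (fun _ => (1 : ℂ)) η n := by
  -- the exponential is the Fourier transform of a Dirac measure
  have e : (expChar U η).toFun =ᶠ[𝓝 x]
      VectorFourier.fourierIntegral 𝐞 (Measure.dirac η)
        (ContinuousLinearMap.toLinearMap₁₂ (innerSL ℝ)) (fun _ => (1 : ℂ)) := by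
    filter_upwards [U.isOpen.mem_nhds hx] with y hy
    rw [expChar_apply η hy, VectorFourier.fourierIntegral, integral_dirac]
    change _ = 𝐞 (-inner ℝ η y) • (1 : ℂ)
    rw [real_inner_comm, Circle.smul_def, smul_eq_mul, mul_one]
  rw [Filter.EventuallyEq.eq_of_nhds (e.iteratedFDeriv ℝ n),
    VectorFourier.iteratedFDeriv_fourierIntegral (N := ⊤) (innerSL ℝ)
      (fun n _ => integrable_dirac (by simp)) aestronglyMeasurable_const
      (by exact_mod_cast le_top), VectorFourier.fourierIntegral, integral_dirac]
  rfl

theorem norm_iteratedFDeriv_expChar_le (η : EuclideanSpace ℝ (Fin d)) (n : ℕ)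
    {x : EuclideanSpace ℝ (Fin d)} (hx : x ∈ U) :
    ‖iteratedFDeriv ℝ n (expChar U η).toFun x‖ ≤ (2 * Real.pi) ^ n * (1 + ‖η‖) ^ n := by
  rw [iteratedFDeriv_expChar η n hx, Circle.norm_smul]
  refine (VectorFourier.norm_fourierPowSMulRight_le _ _ _ _).trans ?_
  rw [norm_one, mul_one]
  have h1 : ‖innerSL ℝ (E := EuclideanSpace ℝ (Fin d))‖ ≤ 1 := norm_innerSL_le ℝ
  have := Real.pi_pos
  refine mul_le_mul (pow_le_pow_left₀ (by positivity) ?_ n)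
    (pow_le_pow_left₀ (norm_nonneg η) (by linarith) n) (by positivity) (by positivity)
  exact mul_le_of_le_one_right (by positivity) h1

theorem seminormFamily_expChar_le (i : SeminormIndex U) (η : EuclideanSpace ℝ (Fin d)) :
    seminormFamily U i (expChar U η) ≤ (2 * Real.pi) ^ i.2 * (1 + ‖η‖) ^ i.2 := by
  have := Real.pi_pos
  exact supSeminorm_le (by positivity) fun x hx =>
    norm_iteratedFDeriv_expChar_le η i.2 (i.1.2 hx)

theorem norm_jet_expChar_le (i : SeminormIndex U) (η : EuclideanSpace ℝ (Fin d)) :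
    ‖jet i (expChar U η)‖ ≤ (2 * Real.pi) ^ i.2 * (1 + ‖η‖) ^ i.2 := by
  have := Real.pi_pos
  exact norm_jetSpace_le (by positivity) fun x =>
    norm_iteratedFDeriv_expChar_le η i.2 (i.1.2 x.2)

theorem continuous_jet_expChar (i : SeminormIndex U) :
    Continuous fun η => jet i (expChar U η) := by
  let G : C(EuclideanSpace ℝ (Fin d) × i.1.1, EuclideanSpace ℝ (Fin d) [×i.2]→L[ℝ] ℂ) :=
    ⟨fun p => 𝐞 (-inner ℝ p.1 (p.2 : EuclideanSpace ℝ (Fin d))) •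
      VectorFourier.fourierPowSMulRight (innerSL ℝ) (fun _ => (1 : ℂ)) p.1 i.2, by
      have h1 : Continuous fun η : EuclideanSpace ℝ (Fin d) =>
          VectorFourier.fourierPowSMulRight (innerSL ℝ) (fun _ => (1 : ℂ)) η i.2 :=
        continuous_const.fourierPowSMulRight _ _
      have h2 : Continuous fun p : EuclideanSpace ℝ (Fin d) × i.1.1 =>
          𝐞 (-inner ℝ p.1 (p.2 : EuclideanSpace ℝ (Fin d))) :=
        Real.continuous_fourierChar.comp (by fun_prop)
      exact h2.smul (h1.comp continuous_fst)⟩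
  have : (fun η => jet i (expChar U η)) = fun η => (G.curry η : JetSpace i) :=
    funext fun η => jetSpace_ext fun x => iteratedFDeriv_expChar η i.2 (i.1.2 x.2)
  rw [this]
  exact G.curry.continuous

end SmoothSpace

open SmoothSpace

/-- Every element of `𝓔'(U)` is a continuous linear form in finitely many jets. -/
theorem exists_jet_factorization {U : Opens (EuclideanSpace ℝ (Fin d))}
    (w : CompactDistribution U) :
    ∃ (s : Finset (SeminormIndex U)) (ℓ : ((i : s) → JetSpace i.1) →L[ℂ] ℂ),
      ∀ φ, w φ = ℓ fun i => jet i.1 φ := by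
  obtain ⟨s, C, -, hC⟩ := Seminorm.bound_of_continuous withSeminorms
    ((normSeminorm ℂ ℂ).comp w.toLinearMap) (continuous_norm.comp w.continuous)
  obtain ⟨ℓ, hℓ⟩ := exists_factorization (LinearMap.pi fun i : s => jet i.1) w.toLinearMap C
    fun φ => by
      refine (hC φ).trans ?_
      change (C : ℝ) * (s.sup (seminormFamily U)) φ ≤ _
      gcongr
      refine Seminorm.finset_sup_apply_le
        (norm_nonneg (LinearMap.pi (fun i : s => jet i.1) φ)) fun i hi => ?_
      exact (seminormFamily_le_norm_jet i φ).trans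
        (norm_le_pi_norm (LinearMap.pi (fun i : s => jet i.1) φ) ⟨i, hi⟩)
  exact ⟨s, ℓ, hℓ⟩

theorem continuous_fourierTransform {U : Opens (EuclideanSpace ℝ (Fin d))}
    (w : CompactDistribution U) : Continuous (fourierTransform w) := by
  obtain ⟨s, ℓ, hℓ⟩ := exists_jet_factorization w
  have : fourierTransform w = fun η => ℓ fun i : s => jet i.1 (expChar U η) :=
    funext fun η => hℓ _
  rw [this]
  exact ℓ.continuous.comp (continuous_pi fun i => continuous_jet_expChar i.1)

theorem integrable_one_add_norm_pow_mul (g : SchwartzMap (EuclideanSpace ℝ (Fin d)) ℂ) (M : ℕ) :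
    Integrable fun η => (1 + ‖η‖) ^ M * ‖g η‖ := by
  have h := ((g.integrable_pow_mul volume 0).add (g.integrable_pow_mul volume M)).const_mul
    (2 ^ (M - 1))
  refine h.mono' (by fun_prop) (Eventually.of_forall fun η => ?_)
  rw [Real.norm_of_nonneg (by positivity)]
  have := add_pow_le zero_le_one (norm_nonneg η) M
  calc (1 + ‖η‖) ^ M * ‖g η‖ ≤ 2 ^ (M - 1) * (1 ^ M + ‖η‖ ^ M) * ‖g η‖ := by gcongr
    _ = _ := by simp only [one_pow, Pi.add_apply, pow_zero]; ring

theorem fourierPowSMulRight_eq_smul (g : EuclideanSpace ℝ (Fin d) → ℂ)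
    (η : EuclideanSpace ℝ (Fin d)) (n : ℕ) :
    VectorFourier.fourierPowSMulRight (innerSL ℝ) g η n
      = g η • VectorFourier.fourierPowSMulRight (innerSL ℝ) (fun _ => (1 : ℂ)) η n := by
  ext m
  simp only [smul_apply, VectorFourier.fourierPowSMulRight_apply]
  simp only [smul_eq_mul, Complex.real_smul]
  ring

/-- Parseval's formula: an element of `𝓔'(U)` may be applied under the integral sign to a
superposition of exponentials. -/
theorem apply_fourier_eq_integral {U : Opens (EuclideanSpace ℝ (Fin d))}
    (w : CompactDistribution U) (g : SchwartzMap (EuclideanSpace ℝ (Fin d)) ℂ)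
    (Φ : SmoothSpace U) (hΦ : ∀ x ∈ U, Φ.toFun x = 𝓕 (g : EuclideanSpace ℝ (Fin d) → ℂ) x) :
    w Φ = ∫ η, g η * fourierTransform w η := by
  obtain ⟨s, ℓ, hℓ⟩ := exists_jet_factorization w
  set H : EuclideanSpace ℝ (Fin d) → ((i : s) → JetSpace i.1) :=
    fun η i => jet i.1 (expChar U η) with hH
  have hHc : Continuous H := continuous_pi fun i => continuous_jet_expChar i.1
  set M := s.sup fun i => i.2
  have hHb : ∀ η, ‖H η‖ ≤ (2 * Real.pi) ^ M * (1 + ‖η‖) ^ M := by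
    intro η
    have := Real.pi_gt_three
    refine (pi_norm_le_iff_of_nonneg (by positivity)).2 fun i => ?_
    refine (norm_jet_expChar_le i.1 η).trans ?_
    have hi : i.1.2 ≤ M := Finset.le_sup (f := fun i : SeminormIndex U => i.2) i.2
    gcongr
    · linarith
    · linarith [norm_nonneg η]
  have hint : Integrable fun η => g η • H η := by
    refine ((integrable_one_add_norm_pow_mul g M).const_mul ((2 * Real.pi) ^ M)).mono'
      (g.continuous.smul hHc).aestronglyMeasurable (Eventually.of_forall fun η => ?_)
    rw [norm_smul]
    calc _ ≤ ‖g η‖ * ((2 * Real.pi) ^ M * (1 + ‖η‖) ^ M) := by gcongr; exact hHb η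
      _ = _ := by ring
  have hJ : (fun i : s => jet i.1 Φ) = ∫ η, g η • H η := by
    funext i
    refine jetSpace_ext fun x => ?_
    set T : ((i : s) → JetSpace i.1) →L[ℂ] EuclideanSpace ℝ (Fin d) [×i.1.2]→L[ℝ] ℂ :=
      (evalJet i.1 x).comp (ContinuousLinearMap.proj i)
    change _ = T (∫ η, g η • H η)
    rw [← T.integral_comp_comm hint]
    have hx : (x : EuclideanSpace ℝ (Fin d)) ∈ U := i.1.1.2 x.2
    have e : Φ.toFun =ᶠ[𝓝 (x : EuclideanSpace ℝ (Fin d))]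
        𝓕 (g : EuclideanSpace ℝ (Fin d) → ℂ) := by
      filter_upwards [U.isOpen.mem_nhds hx] with y hy using hΦ y hy
    rw [evalJet_jet, Filter.EventuallyEq.eq_of_nhds (e.iteratedFDeriv ℝ i.1.2),
      Real.iteratedFDeriv_fourier (N := ⊤) (fun n _ => g.integrable_pow_mul volume n)
        g.continuous.aestronglyMeasurable (by exact_mod_cast le_top), Real.fourier_eq]
    refine integral_congr_ae (Eventually.of_forall fun η => ?_)
    change _ = T (g η • H η)
    rw [map_smul]
    change _ = g η • iteratedFDeriv ℝ i.1.2 (expChar U η).toFun x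
    rw [iteratedFDeriv_expChar η _ hx]
    simp only [fourierPowSMulRight_eq_smul (g : EuclideanSpace ℝ (Fin d) → ℂ)]
    rw [smul_comm]
  rw [hℓ, hJ, ← ℓ.integral_comp_comm hint]
  refine integral_congr_ae (Eventually.of_forall fun η => ?_)
  simp only [map_smul, smul_eq_mul]
  rw [fourierTransform, hℓ]

/-- Parseval's formula for test functions. -/
theorem apply_eq_integral_fourierInv {U : Opens (EuclideanSpace ℝ (Fin d))}
    (w : CompactDistribution U) {F : EuclideanSpace ℝ (Fin d) → ℂ} (hF : ContDiff ℝ ∞ F)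
    (hs : HasCompactSupport F) (Φ : SmoothSpace U) (hΦ : ∀ x ∈ U, Φ.toFun x = F x) :
    w Φ = ∫ η, 𝓕⁻ F η * fourierTransform w η := by
  set S : SchwartzMap (EuclideanSpace ℝ (Fin d)) ℂ := hs.toSchwartzMap hF with hS
  have hSF : (S : EuclideanSpace ℝ (Fin d) → ℂ) = F := rfl
  rw [apply_fourier_eq_integral w (𝓕⁻ S) Φ fun x hx => ?_, SchwartzMap.fourierInv_coe, hSF]
  rw [← SchwartzMap.fourier_coe, FourierTransform.fourier_fourierInv_eq, hSF, hΦ x hx]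

/-- The Fourier transforms of a bounded sequence in `𝓔'(U)` have a common polynomial bound. If
not, exponentials rescaled to form a bounded subset of `C^∞(U)` would contradict boundedness in
the strong dual. -/
theorem exists_fourierTransform_le {U : Opens (EuclideanSpace ℝ (Fin d))}
    {uN : ℕ → CompactDistribution U} (hb : Bornology.IsVonNBounded ℂ (range uN)) :
    ∃ M : ℕ, ∀ N ξ, ‖fourierTransform (uN N) ξ‖ ≤ (M + 1) * (1 + ‖ξ‖) ^ M := by
  by_contra! h
  choose N ξ hξ using h
  set b : ℕ → SmoothSpace U := fun M => (((1 + ‖ξ M‖) ^ M : ℝ) : ℂ)⁻¹ • expChar U (ξ M) with hbdef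
  have hpos : ∀ M, 0 < (1 + ‖ξ M‖) ^ M := fun M => by positivity
  have hB : Bornology.IsVonNBounded ℂ (range b) := by
    rw [SmoothSpace.withSeminorms.isVonNBounded_iff_seminorm_bounded]
    intro i
    have hπ := Real.pi_pos
    refine ⟨(2 * Real.pi) ^ i.2 + ∑ M ∈ Finset.range i.2, seminormFamily U i (b M) + 1, ?_, ?_⟩
    · have : 0 ≤ ∑ M ∈ Finset.range i.2, seminormFamily U i (b M) :=
        Finset.sum_nonneg fun _ _ => apply_nonneg _ _
      positivity
    · rintro _ ⟨M, rfl⟩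
      have hsum : 0 ≤ ∑ M ∈ Finset.range i.2, seminormFamily U i (b M) :=
        Finset.sum_nonneg fun _ _ => apply_nonneg _ _
      rcases lt_or_ge M i.2 with hM | hM
      · have h1 := Finset.single_le_sum (f := fun M => seminormFamily U i (b M))
          (fun _ _ => apply_nonneg _ _) (Finset.mem_range.2 hM)
        have h2 : 0 ≤ (2 * Real.pi) ^ i.2 := by positivity
        linarith
      · have h1 : seminormFamily U i (b M) ≤ (2 * Real.pi) ^ i.2 := by
          rw [hbdef]
          simp only [map_smul_eq_mul, norm_inv, Complex.norm_real, Real.norm_eq_abs,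
            abs_of_pos (hpos M)]
          rw [inv_mul_le_iff₀ (hpos M), mul_comm]
          refine (seminormFamily_expChar_le i (ξ M)).trans ?_
          gcongr
          linarith [norm_nonneg (ξ M)]
        linarith
  have h1 := (ContinuousLinearMap.isVonNBounded_iff.1 hb) _ hB
  obtain ⟨r, hr⟩ := (NormedSpace.isVonNBounded_iff' ℂ).1 h1
  obtain ⟨M, hM⟩ := exists_nat_ge r
  have h2 := hr _ (mem_image2_of_mem (mem_range_self (N M)) (mem_range_self M))
  have h3 := hξ M
  have h4 : ‖uN (N M) (b M)‖ = ((1 + ‖ξ M‖) ^ M)⁻¹ * ‖fourierTransform (uN (N M)) (ξ M)‖ := by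
    rw [hbdef, map_smul, norm_smul, norm_inv, Complex.norm_real, Real.norm_eq_abs,
      abs_of_pos (hpos M)]
    rfl
  rw [h4, inv_mul_le_iff₀ (hpos M)] at h2
  nlinarith [hpos M]

/-- Multiplication by a smooth function, as a continuous operator on `C^∞(U)`. -/
noncomputable def mulOperator (U : Opens (EuclideanSpace ℝ (Fin d)))
    {χ : EuclideanSpace ℝ (Fin d) → ℝ} (hχ : ContDiff ℝ ∞ χ)
    (hb : ∀ k, ∃ C, ∀ x, ‖iteratedFDeriv ℝ k χ x‖ ≤ C) : SmoothSpace U →L[ℂ] SmoothSpace U :=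
  let l : SmoothSpace U →ₗ[ℂ] SmoothSpace U :=
    { toFun := fun φ => ⟨fun x => χ x • φ.toFun x, hχ.contDiffOn.smul φ.2.1, fun x hx => by
        exact (congrArg (χ x • ·) (φ.2.2 x hx)).trans (smul_zero _)⟩
      map_add' := fun φ ψ => Subtype.ext <| funext fun x => smul_add (χ x) (φ.toFun x) (ψ.toFun x)
      map_smul' := fun c φ => Subtype.ext <| funext fun x => smul_comm (χ x) c (φ.toFun x) }
  { l with
    cont := by
      classical
      refine WithSeminorms.continuous_of_isBounded SmoothSpace.withSeminorms
        SmoothSpace.withSeminorms l fun i => ?_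
      choose C hC using hb
      have hC0 : ∀ k, 0 ≤ C k := fun k => (norm_nonneg _).trans (hC k 0)
      set s : Finset (SeminormIndex U) := (Finset.range (i.2 + 1)).image fun j => (i.1, j)
      refine ⟨s, ⟨∑ j ∈ Finset.range (i.2 + 1), (i.2.choose j : ℝ) * C j,
        Finset.sum_nonneg fun j _ => mul_nonneg (by positivity) (hC0 j)⟩, fun φ => ?_⟩
      change supSeminorm i.1.1 i.1.2 i.2 (l φ) ≤
        (∑ j ∈ Finset.range (i.2 + 1), (i.2.choose j : ℝ) * C j) * (s.sup (seminormFamily U)) φ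
      refine supSeminorm_le (mul_nonneg (Finset.sum_nonneg fun j _ => mul_nonneg (by positivity)
        (hC0 j)) (apply_nonneg _ _)) fun x hx => ?_
      have hxU := i.1.2 hx
      have h1 := norm_iteratedFDerivWithin_smul_le (s := U) hχ.contDiffOn φ.2.1
        U.isOpen.uniqueDiffOn hxU (n := i.2) (by exact_mod_cast le_top)
      simp only [iteratedFDerivWithin_of_isOpen _ U.isOpen hxU] at h1
      refine h1.trans ?_
      rw [Finset.sum_mul]
      refine Finset.sum_le_sum fun j hj => ?_
      have hmem : (i.1, i.2 - j) ∈ s :=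
        Finset.mem_image.2 ⟨i.2 - j, Finset.mem_range.2 (by omega), rfl⟩
      have h2 : ‖iteratedFDeriv ℝ (i.2 - j) φ.toFun x‖ ≤ (s.sup (seminormFamily U)) φ :=
        (φ.norm_apply_le_supSeminorm i.1.2 (i.2 - j) hx).trans
          ((Finset.le_sup (f := seminormFamily U) hmem : _ ≤ s.sup (seminormFamily U)) φ)
      have := hC0 j
      gcongr
      · exact hC j x
      · exact h2 }

theorem mulOperator_apply (U : Opens (EuclideanSpace ℝ (Fin d)))
    {χ : EuclideanSpace ℝ (Fin d) → ℝ} (hχ : ContDiff ℝ ∞ χ)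
    (hb : ∀ k, ∃ C, ∀ x, ‖iteratedFDeriv ℝ k χ x‖ ≤ C) (φ : SmoothSpace U)
    (x : EuclideanSpace ℝ (Fin d)) :
    (mulOperator U hχ hb φ).toFun x = χ x * φ.toFun x := rfl

/-! ### Fourier integrals of functions with weighted decay -/

/-- Rapid decay in terms of weights gives weighted bounds for all moments. -/
theorem exists_moment_le {τ σ : ℝ} (hτ : 0 < τ) (hσ : 1 < σ)
    {G : EuclideanSpace ℝ (Fin d) → ℂ} (hG : Continuous G) {B b : ℝ} (hB : 0 ≤ B) (hb : 0 ≤ b)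
    (h : ∀ (k : ℕ) (ξ : EuclideanSpace ℝ (Fin d)), ‖ξ‖ ^ k * ‖G ξ‖ ≤ B * weight τ σ b k) (M : ℕ) :
    ∃ C c : ℝ, 0 ≤ C ∧ 0 ≤ c ∧ ∀ k : ℕ,
      Integrable (fun ξ => ‖ξ‖ ^ k * (1 + ‖ξ‖) ^ M * ‖G ξ‖) ∧
        ∫ ξ, ‖ξ‖ ^ k * (1 + ‖ξ‖) ^ M * ‖G ξ‖ ≤ C * weight τ σ c k := by
  set K := M + (d + 1) with hK
  obtain ⟨A, b₁, hA, hb₁, hshift⟩ := exists_weight_add_le hτ hσ hb K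
  set c := max b b₁
  set C₀ := 2 ^ (K - 1) * (B + B * A) with hC₀
  have hC₀0 : 0 ≤ C₀ := by positivity
  set J : EuclideanSpace ℝ (Fin d) → ℝ := fun ξ => (1 + ‖ξ‖) ^ (-((d : ℝ) + 1)) with hJ
  have hJi : Integrable J := integrable_one_add_norm (by simp)
  have hJ0 : ∀ ξ, 0 ≤ J ξ := fun ξ => by positivity
  have hpt : ∀ (k : ℕ) (ξ : EuclideanSpace ℝ (Fin d)),
      ‖ξ‖ ^ k * (1 + ‖ξ‖) ^ M * ‖G ξ‖ ≤ C₀ * weight τ σ c k * J ξ := by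
    intro k ξ
    have hpow := add_pow_le zero_le_one (norm_nonneg ξ) K
    rw [one_pow] at hpow
    have h1 : ‖ξ‖ ^ k * (1 + ‖ξ‖) ^ K * ‖G ξ‖ ≤ C₀ * weight τ σ c k := by
      calc ‖ξ‖ ^ k * (1 + ‖ξ‖) ^ K * ‖G ξ‖
          ≤ ‖ξ‖ ^ k * (2 ^ (K - 1) * (1 + ‖ξ‖ ^ K)) * ‖G ξ‖ := by gcongr
        _ = 2 ^ (K - 1) * (‖ξ‖ ^ k * ‖G ξ‖ + ‖ξ‖ ^ (k + K) * ‖G ξ‖) := by rw [pow_add]; ring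
        _ ≤ 2 ^ (K - 1) * (B * weight τ σ c k + B * (A * weight τ σ c k)) := by
            refine mul_le_mul_of_nonneg_left (add_le_add ?_ ?_) (by positivity)
            · exact (h k ξ).trans
                (mul_le_mul_of_nonneg_left (weight_mono (le_max_left _ _) k) hB)
            · exact (h _ ξ).trans (mul_le_mul_of_nonneg_left ((hshift k).trans
                (mul_le_mul_of_nonneg_left (weight_mono (le_max_right _ _) k) hA.le)) hB)
        _ = _ := by rw [hC₀]; ring
    have h2 : J ξ * (1 + ‖ξ‖) ^ (d + 1) = 1 := by
      have hpos : 0 < 1 + ‖ξ‖ := by positivity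
      rw [hJ]
      simp only
      rw [Real.rpow_neg hpos.le, show (d : ℝ) + 1 = ((d + 1 : ℕ) : ℝ) by push_cast; ring,
        Real.rpow_natCast]
      exact inv_mul_cancel₀ (by positivity)
    calc ‖ξ‖ ^ k * (1 + ‖ξ‖) ^ M * ‖G ξ‖
        = ‖ξ‖ ^ k * (1 + ‖ξ‖) ^ M * ‖G ξ‖ * (J ξ * (1 + ‖ξ‖) ^ (d + 1)) := by rw [h2, mul_one]
      _ = ‖ξ‖ ^ k * (1 + ‖ξ‖) ^ K * ‖G ξ‖ * J ξ := by rw [hK, pow_add]; ring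
      _ ≤ _ := mul_le_mul_of_nonneg_right h1 (hJ0 ξ)
  refine ⟨C₀ * ∫ ξ, J ξ, c, mul_nonneg hC₀0 (integral_nonneg hJ0), le_max_of_le_left hb,
    fun k => ?_⟩
  have hint : Integrable fun ξ => ‖ξ‖ ^ k * (1 + ‖ξ‖) ^ M * ‖G ξ‖ := by
    refine (hJi.const_mul (C₀ * weight τ σ c k)).mono'
      (Continuous.aestronglyMeasurable (by fun_prop)) (Eventually.of_forall fun ξ => ?_)
    rw [Real.norm_of_nonneg (by positivity)]
    exact hpt k ξ
  refine ⟨hint, (integral_mono hint (hJi.const_mul _) (hpt k)).trans (le_of_eq ?_)⟩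
  rw [integral_const_mul]
  ring

theorem partialDeriv_fourier {G : EuclideanSpace ℝ (Fin d) → ℂ}
    (hG : Continuous G) (hm : ∀ k : ℕ, Integrable fun ξ => ‖ξ‖ ^ k * ‖G ξ‖) (i : Fin d) :
    ∃ H : EuclideanSpace ℝ (Fin d) → ℂ, Continuous H ∧ (∀ ξ, ‖H ξ‖ ≤ 2 * Real.pi * ‖ξ‖ * ‖G ξ‖) ∧
      partialDeriv i (𝓕 G) = 𝓕 H := by
  set T := VectorFourier.fourierSMulRight (innerSL ℝ) G with hT
  have hGi : Integrable G :=
    (integrable_norm_iff hG.aestronglyMeasurable).1 (by simpa using hm 0)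
  have hTn : ∀ ξ, ‖T ξ‖ = 2 * Real.pi * ‖ξ‖ * ‖G ξ‖ := by
    intro ξ
    rw [hT, VectorFourier.norm_fourierSMulRight, innerSL_apply_norm]
  have hTi : Integrable T := by
    refine (((hm 1).const_mul (2 * Real.pi))).mono'
      hG.aestronglyMeasurable.fourierSMulRight (Eventually.of_forall fun ξ => ?_)
    rw [hTn, pow_one, mul_assoc]
  have hval : ∀ ξ, T ξ (EuclideanSpace.single i 1)
      = -(2 * Real.pi * Complex.I) * ((inner ℝ ξ (EuclideanSpace.single i 1) : ℝ) * G ξ) := by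
    intro ξ
    rw [hT, VectorFourier.fourierSMulRight_apply, innerSL_apply_apply, smul_eq_mul,
      Complex.real_smul]
  refine ⟨fun ξ => T ξ (EuclideanSpace.single i 1), ?_, fun ξ => ?_, ?_⟩
  · simp only [hval]
    fun_prop
  · refine ((T ξ).le_opNorm _).trans ?_
    rw [hTn]
    simp
  · have h1 := Real.fderiv_fourier hGi (by simpa using hm 1)
    funext ξ
    rw [partialDeriv, h1, Real.fourier_continuousLinearMap_apply hTi]

theorem integrable_pow_mul_of_le {G H : EuclideanSpace ℝ (Fin d) → ℂ}
    (hm : ∀ k : ℕ, Integrable fun ξ => ‖ξ‖ ^ k * ‖G ξ‖) (hH : Continuous H) {n : ℕ}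
    (h : ∀ ξ, ‖H ξ‖ ≤ (2 * Real.pi * ‖ξ‖) ^ n * ‖G ξ‖) (k : ℕ) :
    Integrable fun ξ => ‖ξ‖ ^ k * ‖H ξ‖ := by
  refine ((hm (k + n)).const_mul ((2 * Real.pi) ^ n)).mono'
    (Continuous.aestronglyMeasurable (by fun_prop)) (Eventually.of_forall fun ξ => ?_)
  rw [Real.norm_of_nonneg (by positivity)]
  calc ‖ξ‖ ^ k * ‖H ξ‖ ≤ ‖ξ‖ ^ k * ((2 * Real.pi * ‖ξ‖) ^ n * ‖G ξ‖) := by gcongr; exact h ξ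
    _ = _ := by rw [mul_pow, pow_add]; ring

theorem iterate_partialDeriv_fourier {G : EuclideanSpace ℝ (Fin d) → ℂ}
    (hG : Continuous G) (hm : ∀ k : ℕ, Integrable fun ξ => ‖ξ‖ ^ k * ‖G ξ‖) (i : Fin d) (n : ℕ) :
    ∃ H : EuclideanSpace ℝ (Fin d) → ℂ, Continuous H ∧
      (∀ ξ, ‖H ξ‖ ≤ (2 * Real.pi * ‖ξ‖) ^ n * ‖G ξ‖) ∧ (partialDeriv i)^[n] (𝓕 G) = 𝓕 H := by
  induction n with
  | zero => exact ⟨G, hG, fun ξ => by simp, rfl⟩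
  | succ n ih =>
    obtain ⟨H, hH, hle, heq⟩ := ih
    obtain ⟨H', hH', hle', heq'⟩ := partialDeriv_fourier hH (integrable_pow_mul_of_le hm hH hle) i
    refine ⟨H', hH', fun ξ => (hle' ξ).trans ?_, by
      rw [Function.iterate_succ_apply', heq, heq']⟩
    have := Real.pi_pos
    calc 2 * Real.pi * ‖ξ‖ * ‖H ξ‖
        ≤ 2 * Real.pi * ‖ξ‖ * ((2 * Real.pi * ‖ξ‖) ^ n * ‖G ξ‖) := by gcongr; exact hle ξ
      _ = _ := by rw [pow_succ]; ring

theorem multiDeriv_fourier {G : EuclideanSpace ℝ (Fin d) → ℂ}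
    (hG : Continuous G) (hm : ∀ k : ℕ, Integrable fun ξ => ‖ξ‖ ^ k * ‖G ξ‖) (α : Fin d → ℕ) :
    ∃ H : EuclideanSpace ℝ (Fin d) → ℂ, Continuous H ∧
      (∀ ξ, ‖H ξ‖ ≤ (2 * Real.pi * ‖ξ‖) ^ (∑ i, α i) * ‖G ξ‖) ∧ multiDeriv α (𝓕 G) = 𝓕 H := by
  rw [Fin.sum_univ_def, multiDeriv]
  generalize List.finRange d = l
  induction l with
  | nil => exact ⟨G, hG, fun ξ => by simp, rfl⟩
  | cons i l ih =>
    obtain ⟨H, hH, hle, heq⟩ := ih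
    obtain ⟨H', hH', hle', heq'⟩ :=
      iterate_partialDeriv_fourier hH (integrable_pow_mul_of_le hm hH hle) i (α i)
    refine ⟨H', hH', fun ξ => (hle' ξ).trans ?_, by rw [List.foldr_cons, heq, heq']⟩
    have := Real.pi_pos
    refine (mul_le_mul_of_nonneg_left (hle ξ) (by positivity)).trans (le_of_eq ?_)
    rw [List.map_cons, List.sum_cons, pow_add, mul_assoc (_ ^ α i)]

/-- The Fourier transform of a function with weighted decay belongs to the Roumieu class. -/
theorem isRegularOn_fourier {τ σ : ℝ} (hτ : 0 < τ) (hσ : 1 < σ)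
    {G : EuclideanSpace ℝ (Fin d) → ℂ} (hG : Continuous G) {B b : ℝ} (hB : 0 ≤ B) (hb : 0 ≤ b)
    (h : ∀ (k : ℕ) (ξ : EuclideanSpace ℝ (Fin d)), ‖ξ‖ ^ k * ‖G ξ‖ ≤ B * weight τ σ b k)
    (Ω : Opens (EuclideanSpace ℝ (Fin d))) : IsRegularOn τ σ (𝓕 G) Ω := by
  obtain ⟨C, c, hC, hc, hmom⟩ := exists_moment_le hτ hσ hG hB hb h 0
  simp only [pow_zero, mul_one] at hmom
  have hm : ∀ k : ℕ, Integrable fun ξ => ‖ξ‖ ^ k * ‖G ξ‖ := fun k => (hmom k).1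
  refine ⟨(Real.contDiff_fourier (N := ⊤) fun n _ => hm n).contDiffOn, fun K _ _ =>
    ⟨C + 1, Real.exp (c + Real.log (2 * Real.pi)), by positivity, Real.exp_pos _,
      fun α x _ => ?_⟩⟩
  obtain ⟨H, hH, hle, heq⟩ := multiDeriv_fourier hG hm α
  rw [weight_eq hσ (Real.exp_pos _), Real.log_exp, heq]
  set n := ∑ i, α i
  have hπ := Real.pi_gt_three
  have hHi := integrable_pow_mul_of_le hm hH hle 0
  simp only [pow_zero, one_mul] at hHi
  have hw := weight_pos τ σ (c + Real.log (2 * Real.pi)) n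
  calc ‖𝓕 H x‖ ≤ ∫ ξ, ‖H ξ‖ := VectorFourier.norm_fourierIntegral_le_integral_norm _ _ _ _ _
    _ ≤ ∫ ξ, (2 * Real.pi) ^ n * (‖ξ‖ ^ n * ‖G ξ‖) := by
        refine integral_mono hHi ((hm n).const_mul _) fun ξ => (hle ξ).trans (le_of_eq ?_)
        rw [mul_pow]; ring
    _ = (2 * Real.pi) ^ n * ∫ ξ, ‖ξ‖ ^ n * ‖G ξ‖ := integral_const_mul _ _
    _ ≤ (2 * Real.pi) ^ n * (C * weight τ σ c n) := by gcongr; exact (hmom n).2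
    _ = C * ((2 * Real.pi) ^ n * weight τ σ c n) := by ring
    _ ≤ C * weight τ σ (c + Real.log (2 * Real.pi)) n := by
        gcongr; exact pow_mul_weight_le hσ (by linarith) n
    _ ≤ _ := by gcongr; linarith

/-! ### Decay of the localized Fourier transform in a cone -/

/-- The function `χ(x) e^{-2πi x·ξ}`. -/
noncomputable def modulated (χ : EuclideanSpace ℝ (Fin d) → ℝ) (ξ : EuclideanSpace ℝ (Fin d)) :
    EuclideanSpace ℝ (Fin d) → ℂ :=
  fun x => (χ x : ℂ) * Complex.exp (((-2 * Real.pi * inner ℝ x ξ : ℝ) : ℂ) * Complex.I)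

theorem contDiff_modulated {χ : EuclideanSpace ℝ (Fin d) → ℝ} (hχ : ContDiff ℝ ∞ χ)
    (ξ : EuclideanSpace ℝ (Fin d)) : ContDiff ℝ ∞ (modulated χ ξ) := by
  have h : ContDiff ℝ ∞ fun x : EuclideanSpace ℝ (Fin d) => -2 * Real.pi * inner ℝ x ξ :=
    contDiff_const.mul (contDiff_id.inner ℝ contDiff_const)
  exact (Complex.ofRealCLM.contDiff.comp hχ).mul
    ((Complex.ofRealCLM.contDiff.comp h).mul contDiff_const).cexp

theorem tsupport_modulated_subset (χ : EuclideanSpace ℝ (Fin d) → ℝ)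
    (ξ : EuclideanSpace ℝ (Fin d)) : tsupport (modulated χ ξ) ⊆ tsupport χ :=
  closure_mono fun x hx hx' => hx (by simp [modulated, hx'])

theorem fourierInv_modulated (χ : EuclideanSpace ℝ (Fin d) → ℝ)
    (ξ ζ : EuclideanSpace ℝ (Fin d)) :
    𝓕⁻ (modulated χ ξ) ζ = 𝓕 (fun x => (χ x : ℂ)) (ξ - ζ) := by
  rw [Real.fourierInv_eq', Real.fourier_eq']
  refine integral_congr_ae (Eventually.of_forall fun x => ?_)
  simp only [modulated, smul_eq_mul]
  rw [mul_left_comm, ← Complex.exp_add, mul_comm, inner_sub_right]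
  congr 2
  push_cast
  ring

theorem mulOperator_expChar_apply {U : Opens (EuclideanSpace ℝ (Fin d))}
    {χ : EuclideanSpace ℝ (Fin d) → ℝ} (hχ : ContDiff ℝ ∞ χ)
    (hb : ∀ k, ∃ C, ∀ x, ‖iteratedFDeriv ℝ k χ x‖ ≤ C) (ξ : EuclideanSpace ℝ (Fin d))
    {x : EuclideanSpace ℝ (Fin d)} (hx : x ∈ U) :
    (mulOperator U hχ hb (expChar U ξ)).toFun x = modulated χ ξ x :=
  congrArg ((χ x : ℂ) * ·) (ofFun_toFun_apply _ hx)

/-- The localized distribution `χ u` has weighted Fourier decay in a smaller cone. Its transform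
is the convolution of `χ̂` with `û_N`: frequencies close to `ξ` lie in the cone, where the decay
of `û_N` is used; for the others the decay of `χ̂` outweighs the polynomial growth of `û_N`. -/
theorem exists_decay_in_cone {τ σ : ℝ} (hτ : 0 < τ) (hσ : 1 < σ)
    {U : Opens (EuclideanSpace ℝ (Fin d))} {uN : ℕ → CompactDistribution U}
    (hbdd : Bornology.IsVonNBounded ℂ (range uN)) {Γ : Set (EuclideanSpace ℝ (Fin d))}
    (hΓ : ∀ ξ ∈ Γ, ∀ t : ℝ, 0 < t → t • ξ ∈ Γ) (hdec : DecayOn τ σ uN Γ)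
    {ξ₀ : EuclideanSpace ℝ (Fin d)} {ε : ℝ} (hε : 0 < ε) (hε' : ε ≤ 1 / 2)
    (hball : Metric.ball ξ₀ (2 * ε) ⊆ Γ)
    {χ : EuclideanSpace ℝ (Fin d) → ℝ} (hχ : WeightBounded τ σ χ) (hs : HasCompactSupport χ)
    (hb : ∀ k, ∃ C, ∀ x, ‖iteratedFDeriv ℝ k χ x‖ ≤ C)
    {V : EuclideanSpace ℝ (Fin d) → ℂ}
    (hV : ∀ N ξ, V ξ = uN N (mulOperator U hχ.1 hb (expChar U ξ))) :
    ∃ B b : ℝ, 0 ≤ B ∧ 0 ≤ b ∧ ∀ (m : ℕ) (ξ : EuclideanSpace ℝ (Fin d)), ξ ≠ 0 →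
      ‖ξ‖⁻¹ • ξ ∈ Metric.ball ξ₀ ε → ‖ξ‖ ^ m * ‖V ξ‖ ≤ B * weight τ σ b m := by
  obtain ⟨A, h, hA, hh, hdec⟩ := hdec
  obtain ⟨a, ha, hN⟩ := exists_floor_eq_and_le_weight hτ hσ hh
  obtain ⟨M, hM⟩ := exists_fourierTransform_le hbdd
  obtain ⟨B₀, b₀, hB₀, hb₀, hχdec⟩ := hχ.exists_fourier_decay hτ hσ hs
  set P := 𝓕 (fun x => (χ x : ℂ)) with hP
  have hχi : Integrable fun x => (χ x : ℂ) :=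
    (Complex.continuous_ofReal.comp hχ.1.continuous).integrable_of_hasCompactSupport
      (hs.comp_left Complex.ofReal_zero)
  have hPc : Continuous P := VectorFourier.fourierIntegral_continuous Real.continuous_fourierChar
    (by exact continuous_inner) hχi
  obtain ⟨C₁, c₁, hC₁, hc₁, hmom₁⟩ := exists_moment_le hτ hσ hPc hB₀.le hb₀ hχdec 0
  obtain ⟨C₂, c₂, hC₂, hc₂, hmom₂⟩ := exists_moment_le hτ hσ hPc hB₀.le hb₀ hχdec M
  have hPi := (hmom₁ 0).1
  simp only [pow_zero, one_mul] at hPi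
  set I₀ := ∫ η, ‖P η‖
  have hI₀ : 0 ≤ I₀ := integral_nonneg fun _ => norm_nonneg _
  set D : ℝ := (M + 1) * (1 + ε⁻¹) ^ M with hD
  have hD0 : 0 ≤ D := by positivity
  have hε1 : 1 ≤ ε⁻¹ := (one_le_inv₀ hε).2 (by linarith)
  set b := max (a + Real.log 2) (c₂ + Real.log ε⁻¹)
  refine ⟨A * I₀ + D * C₂, b, by positivity,
    le_max_of_le_left (add_nonneg ha (Real.log_nonneg (by norm_num))), fun m ξ hξ hξΓ => ?_⟩
  obtain ⟨N, hNm, hNw⟩ := hN m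
  have hr : 0 < ‖ξ‖ := norm_pos_iff.2 hξ
  have hpt : ∀ ζ, ‖ξ‖ ^ m * ‖fourierTransform (uN N) ζ‖
      ≤ A * (2 ^ m * weight τ σ a m) + D * ε⁻¹ ^ m * (‖ξ - ζ‖ ^ m * (1 + ‖ξ - ζ‖) ^ M) := by
    intro ζ
    have hw := weight_pos τ σ a m
    rcases lt_or_ge ‖ξ - ζ‖ (ε * ‖ξ‖) with hc | hc
    · have hζΓ : ζ ∈ Γ := by
        have : ‖ξ‖⁻¹ • ζ ∈ Metric.ball ξ₀ (2 * ε) := by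
          rw [Metric.mem_ball] at hξΓ ⊢
          have h1 : dist (‖ξ‖⁻¹ • ζ) (‖ξ‖⁻¹ • ξ) < ε := by
            rw [dist_eq_norm, ← smul_sub, norm_smul, norm_inv, norm_norm, norm_sub_rev,
              inv_mul_lt_iff₀ hr, mul_comm]
            exact hc
          linarith [dist_triangle (‖ξ‖⁻¹ • ζ) (‖ξ‖⁻¹ • ξ) ξ₀]
        have h2 := hΓ _ (hball this) ‖ξ‖ hr
        rwa [smul_smul, mul_inv_cancel₀ hr.ne', one_smul] at h2
      have hζn : ‖ξ‖ / 2 ≤ ‖ζ‖ := by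
        have h1 := norm_sub_norm_le ξ ζ
        nlinarith
      have hζ0 : ζ ≠ 0 := norm_pos_iff.1 (by linarith)
      have h3 := hdec N ζ hζΓ hζ0
      rw [hNm, le_div_iff₀ (by positivity)] at h3
      have h4 : ‖ξ‖ ^ m ≤ 2 ^ m * ‖ζ‖ ^ m := by
        rw [← mul_pow]; gcongr; linarith
      have h5 : 0 ≤ D * ε⁻¹ ^ m * (‖ξ - ζ‖ ^ m * (1 + ‖ξ - ζ‖) ^ M) := by positivity
      calc ‖ξ‖ ^ m * ‖fourierTransform (uN N) ζ‖
          ≤ 2 ^ m * ‖ζ‖ ^ m * ‖fourierTransform (uN N) ζ‖ := by gcongr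
        _ = 2 ^ m * (‖fourierTransform (uN N) ζ‖ * ‖ζ‖ ^ m) := by ring
        _ ≤ 2 ^ m * (A * weight τ σ a m) := by
            exact mul_le_mul_of_nonneg_left
              (h3.trans (mul_le_mul_of_nonneg_left hNw hA.le)) (by positivity)
        _ ≤ _ := by linarith
    · have h1 : ‖ξ‖ ≤ ε⁻¹ * ‖ξ - ζ‖ := by
        rw [← div_eq_inv_mul, le_div_iff₀ hε, mul_comm]; exact hc
      have h2 : 1 + ‖ζ‖ ≤ (1 + ε⁻¹) * (1 + ‖ξ - ζ‖) := by
        have h3 : ‖ζ‖ ≤ ‖ξ‖ + ‖ξ - ζ‖ := by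
          have := norm_sub_le ξ (ξ - ζ)
          rwa [sub_sub_cancel] at this
        have : 0 ≤ ‖ξ - ζ‖ := norm_nonneg _
        nlinarith
      have h5 : 0 ≤ A * (2 ^ m * weight τ σ a m) := by positivity
      calc ‖ξ‖ ^ m * ‖fourierTransform (uN N) ζ‖
          ≤ (ε⁻¹ * ‖ξ - ζ‖) ^ m * ((M + 1) * ((1 + ε⁻¹) * (1 + ‖ξ - ζ‖)) ^ M) := by
            gcongr
            exact (hM N ζ).trans (by gcongr)
        _ = D * ε⁻¹ ^ m * (‖ξ - ζ‖ ^ m * (1 + ‖ξ - ζ‖) ^ M) := by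
            rw [hD, mul_pow, mul_pow]; ring
        _ ≤ _ := by linarith
  set Q : EuclideanSpace ℝ (Fin d) → ℝ := fun η =>
    A * (2 ^ m * weight τ σ a m) * ‖P η‖ + D * ε⁻¹ ^ m * (‖η‖ ^ m * (1 + ‖η‖) ^ M * ‖P η‖) with hQ
  have hQi : Integrable Q := (hPi.const_mul _).add ((hmom₂ m).1.const_mul _)
  have hVeq : V ξ = ∫ ζ, P (ξ - ζ) * fourierTransform (uN N) ζ := by
    rw [hV N ξ, apply_eq_integral_fourierInv (uN N) (contDiff_modulated hχ.1 ξ)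
      (hs.of_isClosed_subset (isClosed_tsupport _) (tsupport_modulated_subset χ ξ)) _
      fun x hx => mulOperator_expChar_apply hχ.1 hb ξ hx]
    simp only [fourierInv_modulated, hP]
  have h1 : ‖ξ‖ ^ m * ‖V ξ‖ ≤ ∫ η, Q η := by
    have e : ((‖ξ‖ ^ m : ℝ) : ℂ) * V ξ
        = ∫ ζ, ((‖ξ‖ ^ m : ℝ) : ℂ) * (P (ξ - ζ) * fourierTransform (uN N) ζ) := by
      rw [hVeq, integral_const_mul]
    have e2 : ‖ξ‖ ^ m * ‖V ξ‖ = ‖((‖ξ‖ ^ m : ℝ) : ℂ) * V ξ‖ := by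
      rw [norm_mul, Complex.norm_real, Real.norm_of_nonneg (by positivity)]
    rw [e2, e, ← integral_sub_left_eq_self Q volume ξ]
    refine norm_integral_le_of_norm_le (hQi.comp_sub_left ξ) (Eventually.of_forall fun ζ => ?_)
    rw [norm_mul, norm_mul, Complex.norm_real, Real.norm_of_nonneg (by positivity)]
    calc ‖ξ‖ ^ m * (‖P (ξ - ζ)‖ * ‖fourierTransform (uN N) ζ‖)
        = ‖P (ξ - ζ)‖ * (‖ξ‖ ^ m * ‖fourierTransform (uN N) ζ‖) := by ring
      _ ≤ ‖P (ξ - ζ)‖ * (A * (2 ^ m * weight τ σ a m)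
            + D * ε⁻¹ ^ m * (‖ξ - ζ‖ ^ m * (1 + ‖ξ - ζ‖) ^ M)) := by gcongr; exact hpt ζ
      _ = Q (ξ - ζ) := by rw [hQ]; ring
  have hwb₁ : 2 ^ m * weight τ σ a m ≤ weight τ σ b m :=
    (pow_mul_weight_le hσ (by norm_num) m).trans (weight_mono (le_max_left _ _) m)
  have hwb₂ : ε⁻¹ ^ m * weight τ σ c₂ m ≤ weight τ σ b m :=
    (pow_mul_weight_le hσ hε1 m).trans (weight_mono (le_max_right _ _) m)
  calc ‖ξ‖ ^ m * ‖V ξ‖ ≤ ∫ η, Q η := h1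
    _ = A * (2 ^ m * weight τ σ a m) * I₀
        + D * ε⁻¹ ^ m * ∫ η, ‖η‖ ^ m * (1 + ‖η‖) ^ M * ‖P η‖ := by
        rw [hQ, integral_add (hPi.const_mul _) ((hmom₂ m).1.const_mul _), integral_const_mul,
          integral_const_mul]
    _ ≤ A * (2 ^ m * weight τ σ a m) * I₀ + D * ε⁻¹ ^ m * (C₂ * weight τ σ c₂ m) := by
        gcongr; exact (hmom₂ m).2
    _ = A * I₀ * (2 ^ m * weight τ σ a m) + D * C₂ * (ε⁻¹ ^ m * weight τ σ c₂ m) := by ring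
    _ ≤ A * I₀ * weight τ σ b m + D * C₂ * weight τ σ b m := by gcongr
    _ = _ := by ring

/-! ### Regularity at points without wave front set -/

/-- Elements of `𝓔'(U)` that agree with `u` near the support of a test function take the same
value on it. -/
theorem EqOnOpen.apply_eq {U : Opens (EuclideanSpace ℝ (Fin d))} {u : 𝓓'(U, ℂ)}
    {w w' : CompactDistribution U} {Ω Ω' : Opens (EuclideanSpace ℝ (Fin d))}
    (hw : EqOnOpen w u Ω) (hw' : EqOnOpen w' u Ω') {F : EuclideanSpace ℝ (Fin d) → ℂ}
    (hF : ContDiff ℝ ∞ F) (hs : HasCompactSupport F) (hFU : tsupport F ⊆ U)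
    (hFΩ : tsupport F ⊆ Ω) (hFΩ' : tsupport F ⊆ Ω') (Φ : SmoothSpace U)
    (hΦ : ∀ x ∈ U, Φ.toFun x = F x) : w Φ = w' Φ := by
  have hre : tsupport (fun x => (F x).re) ⊆ tsupport F :=
    closure_mono fun x hx hx' => hx (by simp [hx'])
  have him : tsupport (fun x => (F x).im) ⊆ tsupport F :=
    closure_mono fun x hx hx' => hx (by simp [hx'])
  let φ₁ : 𝓓(U, ℝ) := ⟨fun x => (F x).re, Complex.reCLM.contDiff.comp hF,
    hs.of_isClosed_subset (isClosed_tsupport _) hre, hre.trans hFU⟩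
  let φ₂ : 𝓓(U, ℝ) := ⟨fun x => (F x).im, Complex.imCLM.contDiff.comp hF,
    hs.of_isClosed_subset (isClosed_tsupport _) him, him.trans hFU⟩
  have hΦ' : Φ = ofTest φ₁ + Complex.I • ofTest φ₂ := by
    refine Subtype.ext (funext fun x => ?_)
    change Φ.toFun x = (ofTest φ₁).toFun x + Complex.I * (ofTest φ₂).toFun x
    rw [ofTest_apply, ofTest_apply, mul_comm]
    change _ = ((F x).re : ℂ) + (F x).im * Complex.I
    rw [Complex.re_add_im]
    by_cases hx : x ∈ U
    · exact hΦ x hx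
    · exact (Φ.2.2 x hx).trans (image_eq_zero_of_notMem_tsupport fun h => hx (hFU h)).symm
  rw [hΦ', map_add, map_add, map_smul, map_smul, hw φ₁ (hre.trans hFΩ), hw φ₂ (him.trans hFΩ),
    hw' φ₁ (hre.trans hFΩ'), hw' φ₂ (him.trans hFΩ')]

theorem integral_fourierInv_mul {φ V : EuclideanSpace ℝ (Fin d) → ℂ} (hφ : Integrable φ)
    (hV : Integrable V) : ∫ η, 𝓕⁻ φ η * V η = ∫ x, φ x * 𝓕 (fun η => V (-η)) x := by
  have h := VectorFourier.integral_fourierIntegral_smul_eq_flip (L := innerₗ _)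
    Real.continuous_fourierChar continuous_inner hφ hV.comp_neg
  rw [flip_innerₗ] at h
  rw [← integral_neg_eq_self]
  simp only [Real.fourierInv_eq_fourier_neg, neg_neg]
  exact h

/-- In dimension `0` every distribution is given by a constant. -/
theorem belongsTo_of_isEmpty {τ σ : ℝ} (hσ : 1 < σ) [IsEmpty (Fin d)]
    {U : Opens (EuclideanSpace ℝ (Fin d))} (u : 𝓓'(U, ℂ)) {x₀ : EuclideanSpace ℝ (Fin d)}
    (hx₀ : x₀ ∈ U) : BelongsTo τ σ u U := by
  have hsub : ∀ x : EuclideanSpace ℝ (Fin d), x = x₀ := fun x => Subsingleton.elim _ _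
  have hU : ∀ x, x ∈ U := fun x => hsub x ▸ hx₀
  let one : 𝓓(U, ℝ) := ⟨fun _ => 1, contDiff_const, isCompact_univ.of_isClosed_subset
    (isClosed_tsupport _) (subset_univ _), fun x _ => hU x⟩
  set v : ℝ := volume.real (univ : Set (EuclideanSpace ℝ (Fin d))) with hv
  have hv0 : v ≠ 0 := by
    have hfin : volume (univ : Set (EuclideanSpace ℝ (Fin d))) < ⊤ :=
      (Set.toFinite _).isCompact.measure_lt_top
    have hpos : volume (univ : Set (EuclideanSpace ℝ (Fin d))) ≠ 0 :=
      isOpen_univ.measure_ne_zero _ univ_nonempty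
    exact (ENNReal.toReal_pos hpos hfin.ne).ne'
  refine ⟨fun _ => u one / v, ⟨contDiffOn_const, fun K _ _ =>
    ⟨‖u one / v‖ + 1, 1, by positivity, one_pos, fun α x _ => ?_⟩⟩, fun φ _ => ?_⟩
  · have hm : multiDeriv α (fun _ : EuclideanSpace ℝ (Fin d) => u one / v)
        = fun _ => u one / v := by
      have : List.finRange d = [] := by
        rw [List.eq_nil_iff_forall_not_mem]
        exact fun i => (IsEmpty.false i).elim
      rw [multiDeriv, this, List.foldr_nil]
    rw [hm]
    simp [Real.zero_rpow (by linarith : σ ≠ 0)]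
  · have hφ : φ = φ x₀ • one := by
      ext x
      rw [hsub x]
      change φ x₀ = φ x₀ * 1
      rw [mul_one]
    have hint : ∀ x, ((φ x : ℝ) : ℂ) * (u one / v) = (φ x₀ : ℂ) * (u one / v) := fun x => by
      rw [hsub x]
    simp only [hint, integral_const, ← hv]
    conv_lhs => rw [hφ]
    rw [map_smul, Complex.real_smul, Complex.real_smul]
    have : (v : ℂ) ≠ 0 := by exact_mod_cast hv0
    field_simp

/-- If no direction over `x₀` belongs to the wave front set, then `u` is regular near `x₀`. -/
theorem exists_belongsTo_of_forall_not_mem_waveFrontSet {τ σ : ℝ} (hτ : 0 < τ) (hσ : 1 < σ)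
    {U : Opens (EuclideanSpace ℝ (Fin d))} {u : 𝓓'(U, ℂ)} {x₀ : EuclideanSpace ℝ (Fin d)}
    (hx₀ : x₀ ∈ U) (h : ∀ ξ₀, (x₀, ξ₀) ∉ waveFrontSet τ σ u) :
    ∃ Ω : Opens (EuclideanSpace ℝ (Fin d)), Ω ≤ U ∧ x₀ ∈ Ω ∧ BelongsTo τ σ u Ω := by
  rcases isEmpty_or_nonempty (Fin d) with hd | hd
  · exact ⟨U, le_rfl, hx₀, belongsTo_of_isEmpty hσ u hx₀⟩
  -- a finite cover of the unit sphere by directions with good cones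
  have hdata : ∀ ξ₀ : Metric.sphere (0 : EuclideanSpace ℝ (Fin d)) 1,
      ∃ (Ω : Opens (EuclideanSpace ℝ (Fin d))) (Γ : Set (EuclideanSpace ℝ (Fin d)))
        (uN : ℕ → CompactDistribution U) (ε : ℝ), x₀ ∈ Ω ∧
        (∀ ξ ∈ Γ, ∀ t : ℝ, 0 < t → t • ξ ∈ Γ) ∧ Bornology.IsVonNBounded ℂ (range uN) ∧
        (∀ N, EqOnOpen (uN N) u Ω) ∧ DecayOn τ σ uN Γ ∧ 0 < ε ∧ ε ≤ 1 / 2 ∧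
        Metric.ball (ξ₀ : EuclideanSpace ℝ (Fin d)) (2 * ε) ⊆ Γ := by
    intro ξ₀
    have h0 : (ξ₀ : EuclideanSpace ℝ (Fin d)) ≠ 0 := ne_zero_of_mem_unit_sphere ξ₀
    have h1 := h ξ₀
    simp only [waveFrontSet, mem_ofPred_eq, not_and, not_not] at h1
    obtain ⟨Ω, -, hxΩ, Γ, ⟨hΓo, hΓc, hΓm⟩, uN, hbdd, heq, hdec⟩ := h1 hx₀ h0
    obtain ⟨r, hr, hrΓ⟩ := Metric.isOpen_iff.1 hΓo _ hΓm
    refine ⟨Ω, Γ, uN, min (r / 2) (1 / 2), hxΩ, hΓc, hbdd, heq, hdec, by positivity,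
      min_le_right _ _, (Metric.ball_subset_ball ?_).trans hrΓ⟩
    linarith [min_le_left (r / 2) (1 / 2)]
  choose Ω Γ uN ε hxΩ hΓc hbdd heq hdec hε hε' hball using hdata
  obtain ⟨t, ht⟩ := (isCompact_sphere (0 : EuclideanSpace ℝ (Fin d)) 1).elim_finite_subcover
    (fun ξ₀ : Metric.sphere (0 : EuclideanSpace ℝ (Fin d)) 1 =>
      Metric.ball (ξ₀ : EuclideanSpace ℝ (Fin d)) (ε ξ₀)) (fun _ => Metric.isOpen_ball)
    fun ξ hξ => mem_iUnion.2 ⟨⟨ξ, hξ⟩, Metric.mem_ball_self (hε _)⟩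
  have hcover : ∀ ξ : EuclideanSpace ℝ (Fin d), ξ ≠ 0 →
      ∃ j ∈ t, ‖ξ‖⁻¹ • ξ ∈ Metric.ball (j : EuclideanSpace ℝ (Fin d)) (ε j) := by
    intro ξ hξ
    have hmem : ‖ξ‖⁻¹ • ξ ∈ Metric.sphere (0 : EuclideanSpace ℝ (Fin d)) 1 := by
      rw [mem_sphere_zero_iff_norm, norm_smul, norm_inv, norm_norm,
        inv_mul_cancel₀ (norm_ne_zero_iff.2 hξ)]
    obtain ⟨j, hj, hj'⟩ := mem_iUnion₂.1 (ht hmem)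
    exact ⟨j, hj, hj'⟩
  obtain ⟨j₀, hj₀, -⟩ := hcover (EuclideanSpace.single (Classical.arbitrary (Fin d)) 1) (by simp)
  -- localization
  have hnhds : ((U : Set (EuclideanSpace ℝ (Fin d))) ∩ ⋂ j ∈ t, (Ω j : Set _)) ∈ 𝓝 x₀ :=
    inter_mem (U.isOpen.mem_nhds hx₀)
      ((biInter_finset_mem t).2 fun j _ => (Ω j).isOpen.mem_nhds (hxΩ j))
  obtain ⟨χ, hχ, hs, hχsub, hχ1⟩ := exists_cutoff hτ hσ x₀ hnhds
  have hχU : tsupport χ ⊆ U := fun x hx => (hχsub hx).1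
  have hχΩ : ∀ j ∈ t, tsupport χ ⊆ Ω j := fun j hj x hx => mem_iInter₂.1 (hχsub hx).2 j hj
  have hb : ∀ k, ∃ C, ∀ x, ‖iteratedFDeriv ℝ k χ x‖ ≤ C := by
    obtain ⟨-, A, a, -, -, hA⟩ := hχ
    exact fun k => ⟨A * weight τ σ a k, hA k⟩
  set v : CompactDistribution U := (uN j₀ 0).comp (mulOperator U hχ.1 hb) with hv
  set V := fourierTransform v with hVdef
  have hVc : Continuous V := continuous_fourierTransform v
  have hV : ∀ j ∈ t, ∀ N ξ, V ξ = uN j N (mulOperator U hχ.1 hb (expChar U ξ)) := by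
    intro j hj N ξ
    have hsub := tsupport_modulated_subset χ ξ
    exact (heq j₀ 0).apply_eq (heq j N) (contDiff_modulated hχ.1 ξ)
      (hs.of_isClosed_subset (isClosed_tsupport _) hsub) (hsub.trans hχU)
      (hsub.trans (hχΩ j₀ hj₀)) (hsub.trans (hχΩ j hj)) _
      fun x hx => mulOperator_expChar_apply hχ.1 hb ξ hx
  have hcone : ∀ j : Metric.sphere (0 : EuclideanSpace ℝ (Fin d)) 1, ∃ B b : ℝ, 0 ≤ B ∧ 0 ≤ b ∧
      (j ∈ t → ∀ (m : ℕ) (ξ : EuclideanSpace ℝ (Fin d)), ξ ≠ 0 →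
        ‖ξ‖⁻¹ • ξ ∈ Metric.ball (j : EuclideanSpace ℝ (Fin d)) (ε j) →
        ‖ξ‖ ^ m * ‖V ξ‖ ≤ B * weight τ σ b m) := by
    intro j
    by_cases hj : j ∈ t
    · obtain ⟨B, b, hB, hb', h'⟩ := exists_decay_in_cone hτ hσ (hbdd j) (hΓc j) (hdec j) (hε j)
        (hε' j) (hball j) hχ hs hb (hV j hj)
      exact ⟨B, b, hB, hb', fun _ => h'⟩
    · exact ⟨0, 0, le_rfl, le_rfl, fun h' => absurd h' hj⟩
  choose B b hB hb0 hBb using hcone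
  have hBs : 0 ≤ ∑ j ∈ t, B j := Finset.sum_nonneg fun j _ => hB j
  have hbs : 0 ≤ ∑ j ∈ t, b j := Finset.sum_nonneg fun j _ => hb0 j
  have hVdec : ∀ (k : ℕ) (ξ : EuclideanSpace ℝ (Fin d)),
      ‖ξ‖ ^ k * ‖V ξ‖ ≤ (‖V 0‖ + ∑ j ∈ t, B j) * weight τ σ (∑ j ∈ t, b j) k := by
    intro k ξ
    have hw := one_le_weight (σ := σ) hτ hbs k
    rcases eq_or_ne ξ 0 with rfl | hξ
    · calc ‖(0 : EuclideanSpace ℝ (Fin d))‖ ^ k * ‖V 0‖ ≤ ‖V 0‖ * 1 := by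
            rw [norm_zero, mul_one]
            exact mul_le_of_le_one_left (norm_nonneg _) (pow_le_one₀ le_rfl zero_le_one)
        _ ≤ _ := mul_le_mul (by linarith) hw zero_le_one (by positivity)
    · obtain ⟨j, hj, hjξ⟩ := hcover ξ hξ
      refine (hBb j hj k ξ hξ hjξ).trans ?_
      have h1 := Finset.single_le_sum (fun i _ => hB i) hj
      have h2 := Finset.single_le_sum (fun i _ => hb0 i) hj
      have h3 := weight_mono (τ := τ) (σ := σ) h2 k
      have h4 := weight_pos τ σ (b j) k
      have h5 := norm_nonneg (V 0)
      gcongr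
      linarith
  have hB' : 0 ≤ ‖V 0‖ + ∑ j ∈ t, B j := by positivity
  obtain ⟨W, hWsub, hWo, hxW⟩ := mem_nhds_iff.1 (inter_mem hχ1 hnhds)
  refine ⟨⟨W, hWo⟩, fun x hx => (hWsub hx).2.1, hxW, 𝓕 (fun η => V (-η)),
    isRegularOn_fourier hτ hσ (hVc.comp continuous_neg) hB' hbs
      (fun k ξ => by simpa using hVdec k (-ξ)) _, fun φ hφ => ?_⟩
  -- on test functions supported where `χ = 1`, Parseval's formula for `χ u` is Fourier inversion
  have hφW : ∀ x ∈ tsupport φ, x ∈ W := fun x hx => hφ hx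
  have hmul : mulOperator U hχ.1 hb (ofTest φ) = ofTest φ := by
    refine Subtype.ext (funext fun x => ?_)
    change (mulOperator U hχ.1 hb (ofTest φ)).toFun x = (ofTest φ).toFun x
    rw [mulOperator_apply, ofTest_apply]
    by_cases hx : x ∈ tsupport φ
    · have : χ x = 1 := (hWsub (hφW x hx)).1
      rw [this, Complex.ofReal_one, one_mul]
    · simp [image_eq_zero_of_notMem_tsupport hx]
  have h1 : u φ = v (ofTest φ) := by
    rw [hv, ContinuousLinearMap.comp_apply, hmul]
    exact (heq j₀ 0 φ fun x hx => mem_iInter₂.1 (hWsub (hφW x hx)).2.2 j₀ hj₀).symm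
  have hφC : ContDiff ℝ ∞ fun x => (φ x : ℂ) := Complex.ofRealCLM.contDiff.comp φ.contDiff
  have hφs : HasCompactSupport fun x => (φ x : ℂ) :=
    φ.hasCompactSupport.comp_left Complex.ofReal_zero
  obtain ⟨C, c, -, -, hmom⟩ := exists_moment_le hτ hσ hVc hB' hbs hVdec 0
  have hVi : Integrable V :=
    (integrable_norm_iff hVc.aestronglyMeasurable).1 (by simpa using (hmom 0).1)
  rw [h1, apply_eq_integral_fourierInv v hφC hφs _ fun x _ => ofTest_apply φ x]
  exact integral_fourierInv_mul (hφC.continuous.integrable_of_hasCompactSupport hφs) hVi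

end TauSigma

theorem theorem3 {d : ℕ} (τ σ : ℝ) (hτ : 0 < τ) (hσ : 1 < σ)
    (U : Opens (EuclideanSpace ℝ (Fin d))) (u : 𝓓'(U, ℂ)) :
    TauSigma.singSupp τ σ u = Prod.fst '' TauSigma.waveFrontSet τ σ u := by
  ext x
  constructor
  · rintro ⟨hxU, hx⟩
    by_contra h
    exact hx (TauSigma.exists_belongsTo_of_forall_not_mem_waveFrontSet hτ hσ hxU
      fun ξ hξ => h ⟨(x, ξ), hξ, rfl⟩)
  · rintro ⟨⟨y, ξ⟩, hξ, rfl⟩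
    exact ⟨hξ.1, fun ⟨Ω, hΩU, hy, hΩ⟩ =>
      TauSigma.not_mem_waveFrontSet_of_belongsTo hτ hσ hΩU hy hΩ ξ hξ⟩
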